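/- Let $\log=\log_2$. For $k\mid n$ let $G_{n,k}$ be the graph on $n$ nodes consisting of $n/k$ cliques $C_1,\dots,C_{n/k}$ of size $k$, with a perfect matching between every two consecutive cliques such that the matching edges form $k$ disjoint paths from $C_1$ to $C_{n/k}$. Every node $v$ initially holds one message $m_v$. Time proceeds in synchronous rounds; in a round every node $u$ sends one message to all of its neighbours. Let $R_u$ be the set of messages known to $u$ (initially $\{m_u\}$), $S_u$ the set of messages already sent by $u$ (initially empty), and $cnt_{u,v}$ the number of times $u$ has received $m_v$ (initially $cnt_{u,u}=1$ and $cnt_{u,v}=0$ for $v\ne u$). The basic algorithm with parameters $\alpha,d$ runs as follows. In round $0$ every node $u$ sends $m_u$. Then there is one random phase of $\tau=\lceil\alpha\log n\rceil$ rounds, followed by consecutive ranking phases of $\tau'=\lceil 8d\tau\log^2 n\rceil$ rounds each. At the start of each phase, every node $u$ sets $\hat B_u:=R_u\setminus S_u$ and fixes a probability distribution on $\hat B_u$: the uniform one in the random phase; in a ranking phase, with $b=|\hat B_u|$ and $H_b=\sum_{i=1}^b 1/i$, the message at position $r$ in the list of $\hat B_u$ sorted increasingly by $cnt_{u,\cdot}$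 (ties broken arbitrarily) gets probability $\frac1{r\,H_b}$. In each round of the phase every node, independently of the other nodes, picks a message of $\hat B_u$ according to its distribution, removes it from $\hat B_u$ and sends it, and the probabilities of the remaining messages are renormalized (a node whose $\hat B_u$ is empty sends nothing). Theorem. Let $c\ge 1$, $\alpha>48c+96$ and $d>c+3$. There is a constant $C$ such that for every function $k=k(n)$ with $k=\omega(\log^3 n)$, for all sufficiently large $n$ with $k\mid n$, and for every way of breaking ties (which may depend on the current configuration), the following holds for the basic algorithm on $G_{n,k}$: with probability at least $1-\frac1{n^c}$, at the end of ranking phase number $n/k$ every node knows the messages of all nodes, and the number of rounds executed until then is at most $C\,\frac{n\log^3 n}{k}$. -/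

import Mathlib

open scoped ENNReal

namespace VertexCongest

/-- The global configuration of an execution on the node set `V`. The message originating at `v` is
identified with `v`. -/
@[ext]
structure Config (V : Type*) where
  /-- the number of rounds executed so far -/
  t : ℕ
  /-- `R u`: the messages received (known) by `u` -/
  R : V → Finset V
  /-- `S u`: the messages already sent by `u` -/
  S : V → Finset V
  /-- `cnt u v`: the number of times that `u` has received the message of `v` -/
  cnt : V → V → ℕ
  /-- `Bhat u`: the buffer of `u` in the current phase, fixed at the start of the phase and only
  shrinking during the phase -/
  Bhat : V → Finset V
  /-- `Prob u`: the probability space of `u`, computed at the start of the current phase -/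
  Prob : V → V → ℝ≥0∞

section Algorithm

variable {V : Type*} [Fintype V] [DecidableEq V]

/-- The start of the execution: every node knows exactly its own message. -/
def Config.init : Config V where
  t := 0
  R u := {u}
  S _ := ∅
  cnt u v := if v = u then 1 else 0
  Bhat _ := ∅
  Prob _ _ := 0

open Classical in
/-- A synchronized round on the graph `G`: every node `u` sends the message `x u` to all of its
neighbours (`x u = none` means that `u` has nothing to send) and receives what its neighbours send.
A sent message is removed from the buffer of the phase. -/
noncomputable def Config.syncRound (G : SimpleGraph V) (c : Config V) (x : V → Option V) :
    Config V where
  t := c.t + 1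
  R u := c.R u ∪ Finset.univ.filter fun v => ∃ w, G.Adj u w ∧ x w = some v
  S u := c.S u ∪ (x u).toFinset
  cnt u v := c.cnt u v + (Finset.univ.filter fun w => G.Adj u w ∧ x w = some v).card
  Bhat u := c.Bhat u \ (x u).toFinset
  Prob := c.Prob

/-- The law of a message popped from the buffer `B` according to `P`: the message `m ∈ B` has
probability `P m / ∑ m' ∈ B, P m'`, so the probabilities of messages of the phase that were already
sent are nullified and the normalization is updated. Nothing is popped from an empty buffer. -/
noncomputable def popDist (B : Finset V) (P : V → ℝ≥0∞) : PMF (Option V) :=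
  open Classical in
  if h : (∑ m ∈ B, P m) ≠ 0 ∧ (∑ m ∈ B, P m) ≠ ∞ then
    (PMF.ofFinset (fun m => if m ∈ B then P m / ∑ m' ∈ B, P m' else 0) B
      (by
        rw [Finset.sum_congr rfl fun m hm => if_pos hm]
        simp only [div_eq_mul_inv]
        rw [← Finset.sum_mul, ENNReal.mul_inv_cancel h.1 h.2])
      (fun _ hm => if_neg hm)).map some
  else PMF.pure none

/-- The joint law of independent choices with laws `p u`, `u : V`. -/
noncomputable def independent {A : Type*} [Fintype A] (p : V → PMF A) : PMF (V → A) :=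
  PMF.ofFintype (fun x => ∏ u, p u (x u)) (by
    have h : ∀ u, ∑ a, p u a = 1 := fun u => by
      rw [← tsum_fintype (L := .unconditional A)]; exact (p u).tsum_coe
    have := Finset.prod_univ_sum (fun _ : V => (Finset.univ : Finset A)) (fun u a => p u a)
    rw [Fintype.piFinset_univ] at this
    rw [← this]
    simp [h])

/-- A random round of a phase: independently, every node pops a message from its buffer according to
its probability space and sends it. -/
noncomputable def phaseRound (G : SimpleGraph V) (c : Config V) : PMF (Config V) :=
  (independent fun u => popDist (c.Bhat u) (c.Prob u)).map (c.syncRound G)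

/-- `N` consecutive rounds of a phase. -/
noncomputable def phaseRounds (G : SimpleGraph V) : ℕ → Config V → PMF (Config V)
  | 0, c => PMF.pure c
  | N + 1, c => (phaseRound G c).bind (phaseRounds G N)

/-- `B u`: the messages known to `u` and not yet sent by `u`. -/
def Config.B (c : Config V) (u : V) : Finset V := c.R u \ c.S u

/-- Start of the random phase: the probability space is uniform on the buffer. -/
noncomputable def Config.startRandom (c : Config V) : Config V :=
  { c with
    Bhat := c.B
    Prob := fun u m => if m ∈ c.B u then ((c.B u).card : ℝ≥0∞)⁻¹ else 0 }

/-- The position (starting from `1`) of `m` in the list `B` sorted increasingly by `cnt`, where ties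
are broken according to `tie`. -/
def rank (B : Finset V) (cnt : V → ℕ) (tie : V ↪ ℕ) (m : V) : ℕ :=
  (B.filter fun m' => cnt m' < cnt m ∨ (cnt m' = cnt m ∧ tie m' ≤ tie m)).card

/-- The ranking function: the message of rank `r` in a buffer of size `b` has probability
`1 / (r * H_b)`, where `H_b` is the `b`-th harmonic number. -/
noncomputable def rankingFunction (B : Finset V) (cnt : V → ℕ) (tie : V ↪ ℕ) (m : V) : ℝ≥0∞ :=
  if m ∈ B then ENNReal.ofReal (1 / ((rank B cnt tie m : ℝ) * (harmonic B.card : ℝ))) else 0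

/-- Start of a ranking phase. -/
noncomputable def Config.startRanking (tie : V → V ↪ ℕ) (c : Config V) : Config V :=
  { c with
    Bhat := c.B
    Prob := fun u => rankingFunction (c.B u) (c.cnt u) (tie u) }

/-- The law of the configuration at the end of ranking phase `p` (for `p = 0`: at the end of the
random phase) of the algorithm on `G`, with random phase of length `τ` and ranking phases of length
`τ'`: first every node sends its own message, then the random phase, then ranking phases. The order
in which a node breaks ties at the start of a ranking phase is given by `tie`; it may depend on the
configuration. -/
noncomputable def basicAlgorithm (G : SimpleGraph V) (τ τ' : ℕ) (tie : Config V → V → V ↪ ℕ) :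
    ℕ → PMF (Config V)
  | 0 => phaseRounds G τ ((Config.init.syncRound G fun u => some u).startRandom)
  | p + 1 => (basicAlgorithm G τ τ' tie p).bind fun c =>
      phaseRounds G τ' (c.startRanking (tie c))

/-- Full information spreading: every node knows the message of every node. -/
def Config.FullSpreading (c : Config V) : Prop := ∀ u v, v ∈ c.R u

end Algorithm

/-- The length `τ = α log n` of the random phase (logarithms are to base `2`). -/
noncomputable def randomPhaseLength (α : ℝ) (n : ℕ) : ℕ := ⌈α * Real.logb 2 n⌉₊

/-- The length `τ' = 8 d τ log² n` of a ranking phase. -/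
noncomputable def rankingPhaseLength (α d : ℝ) (n : ℕ) : ℕ :=
  ⌈8 * d * (randomPhaseLength α n : ℝ) * Real.logb 2 n ^ 2⌉₊

/-- The graph `G_{n,k}` (for `k ∣ n`): `n / k` cliques of size `k` in a row, with a perfect matching
between every two consecutive cliques; `(i, a)` is the node of clique `i` in layer `a`. -/
def graphNK (n k : ℕ) : SimpleGraph (Fin (n / k) × Fin k) :=
  SimpleGraph.boxProd (SimpleGraph.pathGraph (n / k)) (⊤ : SimpleGraph (Fin k))

end VertexCongest

open VertexCongest

/-! The idea is that, once the random phase has mixed each message inside its own clique, the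
counters separate new messages from old ones. Write `gap` for the distance between cliques. The
invariant `Spread M p` describes the end of ranking phase `p`. Messages from gap at most `p` are
known everywhere, and a node that has not sent one of them has received it at least three times. A
message from gap `p + 1` (the frontier) is known to at least three nodes of the clique, but has
reached each node at most twice: from the matching neighbour nearer its origin, and from the clique
mate in the origin's layer. A message from gap `p + 2` is known only in the layer of its origin, so
each node knows at most one per side. Nothing farther is known.

Since 2 < 3, frontier messages are ranked before all old ones, at rank at most `2 * M + 2`
(`Spread.rank_le`), where `M` bounds the frontier messages that a node knows from one side. Each is
therefore popped with probability at least `1 / (r * H)` per round, where `r ≥ 2 * M + 2` and `H`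
bounds the harmonic numbers. Over a ranking phase all of them are sent with high probability
(`Spread.rankingPhase_le`). Once this happens, `Spread (p + 1)` follows deterministically and with
the same `M` (`Spread.step`).

The base case `randomPhase_le` takes `M = 1 + 3τ`. Every message is sent by three nodes of its own
clique, and at most `2τ` nodes of a clique send the message of their matching partner in a given
adjacent clique. Every probability estimate comes from a potential that is a product over the nodes
(`expect_phaseRounds_prod_le`), and a union bound over phases finishes the proof. -/

namespace VertexCongest

/-! ### Expectations under discrete laws and independent choices. -/

section Expectation

variable {α β : Type*}

/-- The expectation of a nonnegative function under a discrete law. -/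
noncomputable def expect (p : PMF α) (f : α → ℝ≥0∞) : ℝ≥0∞ := ∑' a, p a * f a

theorem expect_pure (a : α) (f : α → ℝ≥0∞) : expect (PMF.pure a) f = f a := by
  unfold expect
  rw [tsum_eq_single a]
  · simp
  · intro b hb
    simp [PMF.pure_apply, hb]

theorem expect_bind (p : PMF α) (q : α → PMF β) (f : β → ℝ≥0∞) :
    expect (p.bind q) f = expect p fun a => expect (q a) f := by
  unfold expect
  simp only [PMF.bind_apply, ← ENNReal.tsum_mul_right, ← ENNReal.tsum_mul_left]
  rw [ENNReal.tsum_comm]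
  simp only [mul_assoc]

theorem expect_map (p : PMF α) (g : α → β) (f : β → ℝ≥0∞) :
    expect (p.map g) f = expect p fun a => f (g a) := by
  simp only [PMF.map, expect_bind, Function.comp_apply, expect_pure]

theorem expect_mono {p : PMF α} {f g : α → ℝ≥0∞} (h : ∀ a ∈ p.support, f a ≤ g a) :
    expect p f ≤ expect p g := by
  refine ENNReal.tsum_le_tsum fun a => ?_
  by_cases ha : p a = 0
  · simp [ha]
  · exact mul_le_mul_right (h a ((p.mem_support_iff a).2 ha)) _

theorem expect_const (p : PMF α) (x : ℝ≥0∞) : expect p (fun _ => x) = x := by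
  simp [expect, ENNReal.tsum_mul_right, p.tsum_coe]

theorem expect_const_mul (p : PMF α) (x : ℝ≥0∞) (f : α → ℝ≥0∞) :
    expect p (fun a => x * f a) = x * expect p f := by
  simp only [expect, ← ENNReal.tsum_mul_left, mul_left_comm]

theorem expect_add (p : PMF α) (f g : α → ℝ≥0∞) :
    expect p (fun a => f a + g a) = expect p f + expect p g := by
  simp only [expect, mul_add, ENNReal.tsum_add]

theorem expect_sum {ι : Type*} (p : PMF α) (s : Finset ι) (f : ι → α → ℝ≥0∞) :
    expect p (fun a => ∑ i ∈ s, f i a) = ∑ i ∈ s, expect p (f i) := by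
  classical
  induction s using Finset.induction_on with
  | empty => simp [expect]
  | insert i s hi ih => simp only [Finset.sum_insert hi, expect_add, ih]

theorem expect_ite_eq [DecidableEq α] (p : PMF α) (a : α) (x : ℝ≥0∞) :
    expect p (fun b => if b = a then x else 0) = p a * x := by
  unfold expect
  rw [tsum_eq_single a]
  · simp
  · intro b hb
    simp [hb]

theorem expect_ne [DecidableEq α] (p : PMF α) (a : α) :
    expect p (fun b => if b = a then 0 else 1) = 1 - p a := by
  have h : expect p (fun b => if b = a then 0 else 1) + p a = 1 := by
    calc _ = expect p (fun b => if b = a then 0 else 1) +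
          expect p (fun b => if b = a then 1 else 0) := by rw [expect_ite_eq, mul_one]
      _ = expect p fun _ => 1 := by
          rw [← expect_add]
          congr 1
          ext b
          split_ifs <;> simp
      _ = 1 := expect_const p 1
  exact ENNReal.eq_sub_of_add_eq (p.apply_ne_top a) h

theorem expect_doubling [DecidableEq α] (p : PMF α) (a : α) :
    expect p (fun b => if b = a then 2 else 1) = 1 + p a := by
  calc _ = expect p fun b => 1 + if b = a then 1 else 0 := by
        congr 1
        ext b
        split_ifs <;> norm_num
    _ = 1 + p a := by rw [expect_add, expect_const, expect_ite_eq, mul_one]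

open Classical in
theorem toOuterMeasure_eq_expect (p : PMF α) (s : Set α) :
    p.toOuterMeasure s = expect p fun a => if a ∈ s then 1 else 0 := by
  rw [PMF.toOuterMeasure_apply, expect]
  congr 1
  ext a
  simp [Set.indicator]

theorem expect_independent {V A : Type*} [Fintype V] [DecidableEq V] [Fintype A]
    (p : V → PMF A) (g : V → A → ℝ≥0∞) :
    expect (independent p) (fun x => ∏ u, g u (x u)) = ∏ u, expect (p u) (g u) := by
  classical
  simp only [expect, tsum_fintype, independent, PMF.ofFintype_apply]
  rw [Finset.prod_univ_sum, Fintype.piFinset_univ]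
  simp only [Finset.prod_mul_distrib]

theorem mem_support_independent {V A : Type*} [Fintype V] [DecidableEq V] [Fintype A]
    {p : V → PMF A} {x : V → A} (hx : x ∈ (independent p).support) (u : V) :
    x u ∈ (p u).support := by
  rw [PMF.mem_support_iff, independent, PMF.ofFintype_apply, Finset.prod_ne_zero_iff] at hx
  exact (PMF.mem_support_iff _ _).2 (hx u (Finset.mem_univ u))

end Expectation

/-! ### The law of a popped message. -/

section PopDist

variable {V : Type*} [DecidableEq V]

theorem popDist_some {B : Finset V} {P : V → ℝ≥0∞} (h0 : (∑ m ∈ B, P m) ≠ 0)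
    (h1 : (∑ m ∈ B, P m) ≠ ∞) {m : V} (hm : m ∈ B) :
    popDist B P (some m) = P m / ∑ m' ∈ B, P m' := by
  classical
  rw [popDist, dif_pos ⟨h0, h1⟩, PMF.map_apply, tsum_eq_single m]
  · simp [PMF.ofFinset_apply, hm]
  · intro b hb
    simp [Ne.symm hb]

theorem mem_of_mem_support_popDist {B : Finset V} {P : V → ℝ≥0∞} {m : V}
    (h : some m ∈ (popDist B P).support) : m ∈ B := by
  classical
  unfold popDist at h
  split_ifs at h with h0
  · rw [PMF.mem_support_map_iff] at h
    obtain ⟨a, ha, hm⟩ := h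
    obtain rfl : a = m := by simpa using hm
    by_contra hB
    rw [PMF.mem_support_iff, PMF.ofFinset_apply] at ha
    simp [hB] at ha
  · simp at h

theorem popDist_uniform {B : Finset V} {P : V → ℝ≥0∞} {x : ℝ≥0∞} (h0 : x ≠ 0) (h1 : x ≠ ∞)
    (hP : ∀ m ∈ B, P m = x) {m : V} (hm : m ∈ B) :
    popDist B P (some m) = (B.card : ℝ≥0∞)⁻¹ := by
  have hs : ∑ m ∈ B, P m = B.card * x := by rw [Finset.sum_congr rfl hP]; simp
  have hB : (B.card : ℝ≥0∞) ≠ 0 := by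
    simpa using Finset.ne_empty_of_mem hm
  rw [popDist_some _ _ hm, hs, hP m hm]
  · rw [ENNReal.div_eq_inv_mul, ENNReal.mul_inv (Or.inl hB) (Or.inr h0), mul_assoc,
      ENNReal.inv_mul_cancel h0 h1, mul_one]
  · rw [hs]; exact mul_ne_zero hB h0
  · rw [hs]; exact ENNReal.mul_ne_top (ENNReal.natCast_ne_top _) h1

/-- Renormalizing after messages have left the buffer divides by a mass at most 1. A bound valid at
the start of a phase thus stays valid until the message is sent. -/
theorem le_popDist {B : Finset V} {P : V → ℝ≥0∞} (h1 : (∑ m ∈ B, P m) ≤ 1) {m : V}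
    (hm : m ∈ B) (hP : P m ≠ 0) : P m ≤ popDist B P (some m) := by
  have h0 : (∑ m ∈ B, P m) ≠ 0 := fun h =>
    hP ((Finset.sum_eq_zero_iff.1 h) m hm)
  rw [popDist_some h0 (ne_top_of_le_ne_top ENNReal.one_ne_top h1) hm]
  calc P m = P m / 1 := (div_one _).symm
    _ ≤ _ := ENNReal.div_le_div_left h1 _

end PopDist

/-! ### Ranks and the harmonic ranking weights. -/

section Ranking

variable {V : Type*}

theorem rank_pos {B : Finset V} (cnt : V → ℕ) (tie : V ↪ ℕ) {m : V} (hm : m ∈ B) :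
    0 < rank B cnt tie m :=
  Finset.card_pos.2 ⟨m, by simp [hm]⟩

theorem rank_lt_rank {B : Finset V} {cnt : V → ℕ} {tie : V ↪ ℕ} {m m' : V}
    (hm' : m' ∈ B) (h : cnt m < cnt m' ∨ (cnt m = cnt m' ∧ tie m < tie m')) :
    rank B cnt tie m < rank B cnt tie m' := by
  refine Finset.card_lt_card ⟨fun x hx => ?_, fun hsub => ?_⟩
  · simp only [Finset.mem_filter] at hx ⊢
    exact ⟨hx.1, by omega⟩
  · have := hsub (show m' ∈ _ by simp [hm'])
    simp only [Finset.mem_filter] at this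
    omega

theorem rank_injOn (B : Finset V) (cnt : V → ℕ) (tie : V ↪ ℕ) :
    Set.InjOn (rank B cnt tie) B := by
  intro m hm m' hm' h
  by_contra hne
  have ht : tie m ≠ tie m' := fun h => hne (tie.injective h)
  by_cases h1 : cnt m < cnt m' ∨ (cnt m = cnt m' ∧ tie m < tie m')
  · exact (rank_lt_rank hm' h1).ne h
  · refine (rank_lt_rank hm ?_).ne' h
    omega

/-- Ranks are distinct integers between 1 and the size of the buffer. An inequality suffices,
because `le_popDist` only needs total weight at most 1. -/
theorem sum_inv_rank_le (B : Finset V) (cnt : V → ℕ) (tie : V ↪ ℕ) :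
    ∑ m ∈ B, (1 / (rank B cnt tie m : ℝ)) ≤ (harmonic B.card : ℝ) := by
  rw [← Finset.sum_image (g := rank B cnt tie) (f := fun r : ℕ => 1 / (r : ℝ))
    (rank_injOn B cnt tie), harmonic_eq_sum_Icc]
  push_cast
  simp only [one_div]
  refine Finset.sum_le_sum_of_subset_of_nonneg ?_ fun _ _ _ => by positivity
  intro r hr
  obtain ⟨m, hm, rfl⟩ := Finset.mem_image.1 hr
  exact Finset.mem_Icc.2 ⟨rank_pos cnt tie hm, Finset.card_filter_le _ _⟩

theorem sum_rankingFunction_le [DecidableEq V] (B : Finset V) (cnt : V → ℕ) (tie : V ↪ ℕ) :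
    ∑ m ∈ B, rankingFunction B cnt tie m ≤ 1 := by
  have hH : (0 : ℝ) ≤ (harmonic B.card : ℝ) := by
    rw [harmonic_eq_sum_Icc]; push_cast; positivity
  rw [Finset.sum_congr rfl fun m hm => by rw [rankingFunction, if_pos hm],
    ← ENNReal.ofReal_sum_of_nonneg fun m _ => by positivity, ← ENNReal.ofReal_one]
  refine ENNReal.ofReal_le_ofReal ?_
  simp only [← div_div]
  rw [← Finset.sum_div]
  exact div_le_one_of_le₀ (sum_inv_rank_le B cnt tie) hH

theorem le_rankingFunction [DecidableEq V] {B : Finset V} {cnt : V → ℕ} {tie : V ↪ ℕ} {m : V} (hm : m ∈ B)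
    {r h : ℝ} (hr : (rank B cnt tie m : ℝ) ≤ r) (hh : (harmonic B.card : ℝ) ≤ h) :
    ENNReal.ofReal (1 / (r * h)) ≤ rankingFunction B cnt tie m := by
  have hB : B.card ≠ 0 := Finset.card_ne_zero_of_mem hm
  have h1 : (0 : ℝ) < harmonic B.card := by exact_mod_cast harmonic_pos hB
  have h2 : (0 : ℝ) < rank B cnt tie m := by exact_mod_cast rank_pos cnt tie hm
  rw [rankingFunction, if_pos hm]
  refine ENNReal.ofReal_le_ofReal (one_div_le_one_div_of_le (by positivity) ?_)
  gcongr
  exact h2.le.trans hr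

end Ranking

/-! ### Invariants within a phase and product potentials. -/

section Phases

variable {V : Type*} [Fintype V] [DecidableEq V]

open Classical in
/-- The knowledge and the counters of a configuration are determined by the sets of sent messages,
every message having been sent at most once by each node. -/
structure Config.Valid (G : SimpleGraph V) (c : Config V) : Prop where
  mem_R : ∀ u v, v ∈ c.R u ↔ v = u ∨ ∃ w, G.Adj u w ∧ v ∈ c.S w
  cnt_eq : ∀ u v, c.cnt u v =
    (if v = u then 1 else 0) + (Finset.univ.filter fun w => G.Adj u w ∧ v ∈ c.S w).card
  S_subset : ∀ u, c.S u ⊆ c.R u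

theorem Config.valid_init (G : SimpleGraph V) : (Config.init : Config V).Valid G where
  mem_R u v := by simp [Config.init]
  cnt_eq u v := by simp [Config.init]
  S_subset u := by simp [Config.init]

theorem Config.Valid.syncRound {G : SimpleGraph V} {c : Config V} (hc : c.Valid G)
    {x : V → Option V} (hx : ∀ u v, x u = some v → v ∈ c.B u) : (c.syncRound G x).Valid G where
  mem_R u v := by
    simp only [Config.syncRound, Finset.mem_union, hc.mem_R, Finset.mem_filter, Finset.mem_univ,
      true_and, Option.mem_toFinset, Option.mem_def, and_or_left, exists_or, or_assoc]
  cnt_eq u v := by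
    classical
    simp only [Config.syncRound, hc.cnt_eq, Finset.mem_union, Option.mem_toFinset, Option.mem_def,
      and_or_left, add_assoc]
    rw [Finset.filter_or, Finset.card_union_of_disjoint]
    rw [Finset.disjoint_filter]
    rintro w - ⟨-, h1⟩ ⟨-, h2⟩
    exact (Finset.mem_sdiff.1 (hx w v h2)).2 h1
  S_subset u := by
    intro v hv
    simp only [Config.syncRound, Finset.mem_union, Option.mem_toFinset, Option.mem_def] at hv ⊢
    rcases hv with hv | hv
    · exact Or.inl (hc.S_subset u hv)
    · exact Or.inl (Finset.mem_sdiff.1 (hx u v hv)).1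

/-- The properties of a configuration reached `j` rounds after the start `c₀` of a phase. -/
structure InPhase (G : SimpleGraph V) (c₀ : Config V) (j : ℕ) (c : Config V) : Prop where
  valid : c.Valid G
  Bhat_eq : ∀ u, c.Bhat u = c₀.B u \ c.S u
  Prob_eq : c.Prob = c₀.Prob
  S_mono : ∀ u, c₀.S u ⊆ c.S u
  S_subset : ∀ u, c.S u ⊆ c₀.R u
  card_S_le : ∀ u, (c.S u).card ≤ (c₀.S u).card + j
  t_eq : c.t = c₀.t + j

theorem InPhase.start {G : SimpleGraph V} {c : Config V} (hc : c.Valid G)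
    (hB : c.Bhat = c.B) : InPhase G c 0 c where
  valid := hc
  Bhat_eq u := by simp [hB, Config.B]
  Prob_eq := rfl
  S_mono _ := Finset.Subset.refl _
  S_subset := hc.S_subset
  card_S_le _ := le_rfl
  t_eq := rfl

/-- Knowledge only grows, so what is left of the buffer fixed at the start is still known and
unsent. Hence no node ever sends a message twice, which keeps the counter formula of `Config.Valid`
true. -/
theorem InPhase.Bhat_subset {G : SimpleGraph V} {c₀ c : Config V} {j : ℕ}
    (h : InPhase G c₀ j c) (hc₀ : c₀.Valid G) (u : V) : c.Bhat u ⊆ c.B u := by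
  intro v hv
  rw [h.Bhat_eq, Finset.mem_sdiff, Config.B, Finset.mem_sdiff] at hv
  refine Finset.mem_sdiff.2 ⟨?_, hv.2⟩
  rw [h.valid.mem_R]
  refine ((hc₀.mem_R u v).1 hv.1.1).imp_right ?_
  rintro ⟨w, hw, hv⟩
  exact ⟨w, hw, h.S_mono w hv⟩

theorem InPhase.syncRound {G : SimpleGraph V} {c₀ c : Config V} {j : ℕ}
    (h : InPhase G c₀ j c) (hc₀ : c₀.Valid G) {x : V → Option V}
    (hx : ∀ u v, x u = some v → v ∈ c.Bhat u) : InPhase G c₀ (j + 1) (c.syncRound G x) where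
  valid := h.valid.syncRound fun u v hv => h.Bhat_subset hc₀ u (hx u v hv)
  Bhat_eq u := by
    simp only [Config.syncRound, h.Bhat_eq, sdiff_sdiff_left, Finset.sup_eq_union]
  Prob_eq := h.Prob_eq
  S_mono u := (h.S_mono u).trans Finset.subset_union_left
  S_subset u := by
    refine Finset.union_subset (h.S_subset u) fun v hv => ?_
    have := hx u v (by simpa using hv)
    rw [h.Bhat_eq, Finset.mem_sdiff, Config.B, Finset.mem_sdiff] at this
    exact this.1.1
  card_S_le u := by
    refine (Finset.card_union_le _ _).trans ?_
    rw [← add_assoc]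
    refine add_le_add (h.card_S_le u) ?_
    cases x u <;> simp
  t_eq := by simp [Config.syncRound, h.t_eq, add_assoc]

theorem InPhase.of_mem_support_phaseRound {G : SimpleGraph V} {c₀ c c' : Config V} {j : ℕ}
    (h : InPhase G c₀ j c) (hc₀ : c₀.Valid G) (hc' : c' ∈ (phaseRound G c).support) :
    InPhase G c₀ (j + 1) c' := by
  rw [phaseRound, PMF.mem_support_map_iff] at hc'
  obtain ⟨x, hx, rfl⟩ := hc'
  refine h.syncRound hc₀ fun u v huv => mem_of_mem_support_popDist (P := c.Prob u) ?_
  rw [← huv]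
  exact mem_support_independent hx u

theorem InPhase.of_mem_support_phaseRounds {G : SimpleGraph V} {c₀ : Config V}
    (hc₀ : c₀.Valid G) : ∀ (N j : ℕ) {c c' : Config V}, InPhase G c₀ j c →
    c' ∈ (phaseRounds G N c).support → InPhase G c₀ (j + N) c'
  | 0, j, c, c', h, hc' => by
    rw [phaseRounds, PMF.mem_support_pure_iff] at hc'
    exact hc' ▸ h
  | N + 1, j, c, c', h, hc' => by
    rw [phaseRounds, PMF.mem_support_bind_iff] at hc'
    obtain ⟨d, hd, hc'⟩ := hc'
    have := InPhase.of_mem_support_phaseRounds hc₀ N (j + 1)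
      (h.of_mem_support_phaseRound hc₀ hd) hc'
    rwa [add_right_comm] at this

/-- Within a phase a node's buffer changes only through its own pop, and the pops of one round are
independent, so the expectation factorizes. -/
theorem expect_phaseRound_prod (G : SimpleGraph V) (c : Config V)
    (φ : V → Finset V → ℝ≥0∞) :
    expect (phaseRound G c) (fun c' => ∏ u, φ u (c'.Bhat u)) =
      ∏ u, expect (popDist (c.Bhat u) (c.Prob u)) fun x => φ u (c.Bhat u \ Option.toFinset x) := by
  rw [phaseRound, expect_map]
  exact expect_independent _ fun u x => φ u (c.Bhat u \ Option.toFinset x)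

/-- Potential function estimate: if every node multiplies its share of a product potential by at
most `r u` on average in each round, then the potential decays accordingly over a phase. -/
theorem expect_phaseRounds_prod_le {G : SimpleGraph V} {c₀ : Config V} (hc₀ : c₀.Valid G)
    (φ : V → Finset V → ℝ≥0∞) (r : V → ℝ≥0∞) (T : ℕ)
    (hr : ∀ j < T, ∀ c, InPhase G c₀ j c → ∀ u,
      expect (popDist (c.Bhat u) (c₀.Prob u)) (fun x => φ u (c.Bhat u \ x.toFinset)) ≤
        r u * φ u (c.Bhat u)) :
    ∀ (N j : ℕ) (c : Config V), j + N ≤ T → InPhase G c₀ j c →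
      expect (phaseRounds G N c) (fun c' => ∏ u, φ u (c'.Bhat u)) ≤
        (∏ u, r u) ^ N * ∏ u, φ u (c.Bhat u)
  | 0, j, c, _, h => by rw [phaseRounds, expect_pure, pow_zero, one_mul]
  | N + 1, j, c, hT, h => by
    rw [phaseRounds, expect_bind]
    calc _ ≤ expect (phaseRound G c) fun c' => (∏ u, r u) ^ N * ∏ u, φ u (c'.Bhat u) :=
          expect_mono fun c' hc' => expect_phaseRounds_prod_le hc₀ φ r T hr N (j + 1) c'
            (by omega) (h.of_mem_support_phaseRound hc₀ hc')
      _ = (∏ u, r u) ^ N * ∏ u, expect (popDist (c.Bhat u) (c.Prob u))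
            fun x => φ u (c.Bhat u \ Option.toFinset x) := by
          rw [expect_const_mul, expect_phaseRound_prod]
      _ ≤ (∏ u, r u) ^ N * ∏ u, (r u * φ u (c.Bhat u)) := by
          gcongr with u
          rw [h.Prob_eq]
          exact hr j (by omega) c h u
      _ = _ := by rw [Finset.prod_mul_distrib, pow_succ, mul_assoc]

/-- If a node in `W` pops `m`, as long as it still has `m`, with probability at least `ε` in each
round, then it is unlikely that all the nodes in `W` keep `m` over the whole phase. -/
theorem phaseRounds_keep_le {G : SimpleGraph V} {c₀ : Config V} (hc₀ : c₀.Valid G)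
    (hB : c₀.Bhat = c₀.B) (N : ℕ) (W : Finset V) (m : V) (ε : ℝ)
    (hε : ∀ j c, InPhase G c₀ j c → ∀ u ∈ W, m ∈ c.Bhat u →
      ENNReal.ofReal ε ≤ popDist (c.Bhat u) (c₀.Prob u) (some m)) :
    (phaseRounds G N c₀).toOuterMeasure {c | ∀ u ∈ W, m ∈ c.Bhat u} ≤
      ENNReal.ofReal (Real.exp (-(ε * W.card * N))) := by
  classical
  -- The potential is the indicator that all of `W` still hold `m`; each node of `W` contributes a
  -- factor `1 - ε ≤ exp (-ε)` per round.
  have key := expect_phaseRounds_prod_le hc₀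
    (fun u B => if u ∈ W then (if m ∈ B then 1 else 0) else 1)
    (fun u => if u ∈ W then ENNReal.ofReal (Real.exp (-ε)) else 1) N
    (fun j _ c hc u => by
      by_cases hu : u ∈ W
      swap
      · simp [hu, expect_const]
      by_cases hm : m ∈ c.Bhat u
      swap
      · simp [hu, hm, expect]
      simp only [hu, hm, if_true, mul_one]
      calc _ = expect (popDist (c.Bhat u) (c₀.Prob u))
            (fun x => if x = some m then 0 else 1) := by
            congr 1
            ext x
            by_cases hx : x = some m <;> simp [hm, hx]
        _ ≤ 1 - ENNReal.ofReal ε := by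
            rw [expect_ne]
            exact tsub_le_tsub_left (hε j c hc u hu hm) _
        _ ≤ ENNReal.ofReal (Real.exp (-ε)) := by
            rw [tsub_le_iff_right, ← ENNReal.ofReal_one]
            refine le_trans (ENNReal.ofReal_le_ofReal ?_) ENNReal.ofReal_add_le
            linarith [Real.add_one_le_exp (-ε)])
    N 0 c₀ (by simp) (InPhase.start hc₀ hB)
  have hW : ∏ u, (if u ∈ W then ENNReal.ofReal (Real.exp (-ε)) else 1) =
      ENNReal.ofReal (Real.exp (-(ε * W.card))) := by
    rw [Finset.prod_ite_mem, Finset.univ_inter, Finset.prod_const,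
      ← ENNReal.ofReal_pow (Real.exp_pos _).le, ← Real.exp_nat_mul]
    congr 2; ring
  calc _ = expect (phaseRounds G N c₀)
        (fun c' => ∏ u, if u ∈ W then (if m ∈ c'.Bhat u then 1 else 0) else 1) := by
        rw [toOuterMeasure_eq_expect]
        congr 1
        ext c
        rw [Finset.prod_ite_mem, Finset.univ_inter, Finset.prod_ite_zero]
        simp
    _ ≤ _ := key
    _ ≤ ENNReal.ofReal (Real.exp (-(ε * W.card))) ^ N * 1 := by
        rw [hW]
        gcongr
        refine Finset.prod_le_one' fun u _ => ?_
        split_ifs <;> simp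
    _ = _ := by
        rw [mul_one, ← ENNReal.ofReal_pow (Real.exp_pos _).le, ← Real.exp_nat_mul]
        congr 2; ring

/-- If every node `u ∈ W` pops its message `f u` with probability at most `q` in each round, then
it is unlikely that many of the nodes in `W` do so during the phase. -/
theorem phaseRounds_many_le {G : SimpleGraph V} {c₀ : Config V} (hc₀ : c₀.Valid G)
    (hB : c₀.Bhat = c₀.B) (N : ℕ) (W : Finset V) (f : V → V)
    (hf : ∀ u ∈ W, f u ∈ c₀.B u) {q : ℝ} (h0 : 0 ≤ q)
    (hq : ∀ j < N, ∀ c, InPhase G c₀ j c → ∀ u ∈ W, f u ∈ c.Bhat u →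
      popDist (c.Bhat u) (c₀.Prob u) (some (f u)) ≤ ENNReal.ofReal q) (K : ℕ) :
    (phaseRounds G N c₀).toOuterMeasure {c | K ≤ (W.filter fun u => f u ∈ c.S u).card} ≤
      ENNReal.ofReal (Real.exp (q * W.card * N)) / 2 ^ K := by
  classical
  -- Exponential moment in base 2: the potential doubles whenever some `u ∈ W` pops `f u`, so each
  -- node multiplies its mean by at most `1 + q ≤ exp q` per round.
  have key := expect_phaseRounds_prod_le hc₀
    (fun u B => if u ∈ W then (if f u ∈ B then 1 else 2) else 1)
    (fun u => if u ∈ W then ENNReal.ofReal (Real.exp q) else 1) N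
    (fun j hj c hc u => by
      by_cases hu : u ∈ W
      swap
      · simp [hu, expect_const]
      by_cases hm : f u ∈ c.Bhat u
      · simp only [hu, hm, if_true, mul_one]
        calc _ = expect (popDist (c.Bhat u) (c₀.Prob u))
              (fun x => if x = some (f u) then 2 else 1) := by
              congr 1
              ext x
              by_cases hx : x = some (f u) <;> simp [hm, hx]
          _ ≤ 1 + ENNReal.ofReal q := by
              rw [expect_doubling]
              exact add_le_add le_rfl (hq j hj c hc u hu hm)
          _ ≤ ENNReal.ofReal (Real.exp q) := by
              rw [← ENNReal.ofReal_one, ← ENNReal.ofReal_add zero_le_one h0]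
              exact ENNReal.ofReal_le_ofReal (by linarith [Real.add_one_le_exp q])
      · have h1 : (1 : ℝ≥0∞) ≤ ENNReal.ofReal (Real.exp q) := by
          rw [← ENNReal.ofReal_one]
          exact ENNReal.ofReal_le_ofReal (Real.one_le_exp h0)
        simp only [hu, hm, if_true, if_false, Finset.mem_sdiff, false_and, expect_const]
        exact le_mul_of_one_le_left zero_le h1)
    N 0 c₀ (by simp) (InPhase.start hc₀ hB)
  have hW : ∏ u, (if u ∈ W then ENNReal.ofReal (Real.exp q) else 1) =
      ENNReal.ofReal (Real.exp (q * W.card)) := by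
    rw [Finset.prod_ite_mem, Finset.univ_inter, Finset.prod_const,
      ← ENNReal.ofReal_pow (Real.exp_pos _).le, ← Real.exp_nat_mul]
    congr 2; ring
  have h1 : ∏ u, (if u ∈ W then (if f u ∈ c₀.Bhat u then (1 : ℝ≥0∞) else 2) else 1) = 1 :=
    Finset.prod_eq_one fun u _ => by
      split_ifs with hu h
      · rfl
      · exact absurd (hB ▸ hf u hu) h
      · rfl
  -- Markov's inequality: on the event, the potential is at least `2 ^ K`.
  rw [ENNReal.le_div_iff_mul_le (by simp) (by simp), toOuterMeasure_eq_expect, mul_comm,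
    ← expect_const_mul]
  calc _ ≤ expect (phaseRounds G N c₀)
        (fun c' => ∏ u, if u ∈ W then (if f u ∈ c'.Bhat u then 1 else 2) else 1) := by
        refine expect_mono fun c hc => ?_
        have hc := InPhase.of_mem_support_phaseRounds hc₀ N 0 (InPhase.start hc₀ hB) hc
        rw [Finset.prod_ite_mem, Finset.univ_inter, Finset.prod_ite, Finset.prod_const_one,
          one_mul, Finset.prod_const]
        split_ifs with hK
        · rw [mul_one]
          refine pow_le_pow_right₀ one_le_two (le_trans hK (Finset.card_le_card ?_))
          intro u hu
          rw [Finset.mem_filter] at hu ⊢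
          refine ⟨hu.1, fun h => ?_⟩
          rw [hc.Bhat_eq] at h
          exact (Finset.mem_sdiff.1 h).2 hu.2
        · simp
    _ ≤ _ := key
    _ = _ := by
        rw [h1, mul_one, hW, ← ENNReal.ofReal_pow (Real.exp_pos _).le, ← Real.exp_nat_mul]
        congr 2; ring

end Phases
-- Geometry of the row of cliques and the deterministic invariant.
section CliquePath

/-- A row of `N` cliques of size `k`, consecutive cliques being joined by perfect matchings. -/
abbrev cliquePath (N k : ℕ) : SimpleGraph (Fin N × Fin k) :=
  SimpleGraph.boxProd (SimpleGraph.pathGraph N) (⊤ : SimpleGraph (Fin k))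

variable {N k : ℕ}

/-- The distance between the cliques of two nodes. -/
def gap (u v : Fin N × Fin k) : ℕ := ((u.1 : ℕ) - v.1) + (v.1 - u.1)

theorem cliquePath_adj {u v : Fin N × Fin k} : (cliquePath N k).Adj u v ↔
    (u.1 = v.1 ∧ u.2 ≠ v.2) ∨ (u.2 = v.2 ∧ ((u.1 : ℕ) + 1 = v.1 ∨ (v.1 : ℕ) + 1 = u.1)) := by
  rw [SimpleGraph.boxProd_adj, SimpleGraph.pathGraph_adj, SimpleGraph.top_adj]
  tauto

theorem gap_eq_zero {u v : Fin N × Fin k} : gap u v = 0 ↔ u.1 = v.1 := by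
  unfold gap
  omega

theorem gap_congr {u w : Fin N × Fin k} (h : u.1 = w.1) (v : Fin N × Fin k) :
    gap u v = gap w v := by
  unfold gap
  rw [h]

theorem cliquePath_adj_gap {u w : Fin N × Fin k} (h : (cliquePath N k).Adj u w)
    (v : Fin N × Fin k) : (w.1 = u.1 ∧ gap w v = gap u v) ∨
      (w.2 = u.2 ∧ (gap w v = gap u v + 1 ∨ gap w v + 1 = gap u v)) := by
  rcases cliquePath_adj.1 h with ⟨h1, -⟩ | ⟨h1, h2⟩
  · exact Or.inl ⟨h1.symm, gap_congr h1.symm v⟩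
  · refine Or.inr ⟨h1.symm, ?_⟩
    unfold gap
    omega

theorem exists_toward {u v : Fin N × Fin k} (h : 0 < gap u v) :
    ∃ w, (cliquePath N k).Adj u w ∧ w.2 = u.2 ∧ gap w v + 1 = gap u v := by
  unfold gap at h
  by_cases hlt : (u.1 : ℕ) < v.1
  · refine ⟨(⟨u.1 + 1, by omega⟩, u.2), ?_, rfl, ?_⟩
    · exact cliquePath_adj.2 (Or.inr ⟨rfl, Or.inl rfl⟩)
    · simp only [gap]
      omega
  · refine ⟨(⟨u.1 - 1, by omega⟩, u.2), ?_, rfl, ?_⟩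
    · exact cliquePath_adj.2 (Or.inr ⟨rfl, Or.inr (by simp only; omega)⟩)
    · simp only [gap]
      omega

theorem toward_clique_unique {u v w w' : Fin N × Fin k} (hw : (cliquePath N k).Adj u w)
    (hw' : (cliquePath N k).Adj u w') (h : gap w v + 1 = gap u v) (h' : gap w' v + 1 = gap u v) :
    w = w' := by
  rcases cliquePath_adj.1 hw with ⟨h1, -⟩ | ⟨h1, h2⟩
  · rw [gap_congr h1] at h; omega
  rcases cliquePath_adj.1 hw' with ⟨h1', -⟩ | ⟨h1', h2'⟩
  · rw [gap_congr h1'] at h'; omega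
  refine Prod.ext (Fin.ext ?_) (h1.symm.trans h1')
  unfold gap at h h'
  omega

/-- The state of the information spreading at the end of ranking phase `p`: the messages of cliques
at distance at most `p` are known and were received often, and the only other messages around are
those of cliques at distance `p + 1` and a few of cliques at distance `p + 2`. -/
structure Spread (M p : ℕ) (c : Config (Fin N × Fin k)) : Prop where
  valid : c.Valid (cliquePath N k)
  old : ∀ u v, gap u v ≤ p → v ∈ c.R u ∧ (v ∉ c.S u → 3 ≤ c.cnt u v)
  early : ∀ u v, gap u v = p + 1 → v ∈ c.S u → u.2 = v.2
  far : ∀ u v, p + 2 ≤ gap u v → v ∉ c.S u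
  few : ∀ u v, gap u v = p + 1 → ((c.R u).filter fun m => m.1 = v.1).card ≤ M
  many : ∀ u v, gap u v = p + 1 → 3 ≤ (Finset.univ.filter fun a => v ∈ c.R (u.1, a)).card

variable {M p : ℕ} {c : Config (Fin N × Fin k)}

theorem Config.Valid.mem_R_of_adj {V : Type*} [Fintype V] [DecidableEq V] {G : SimpleGraph V}
    {c : Config V} (hc : c.Valid G) {u v w : V} (hw : G.Adj u w) (hv : v ∈ c.S w) : v ∈ c.R u :=
  (hc.mem_R u v).2 (Or.inr ⟨w, hw, hv⟩)

theorem Config.Valid.mem_R_of_clique (hc : c.Valid (cliquePath N k)) {u v w : Fin N × Fin k}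
    (hw : u.1 = w.1) (hv : v ∈ c.S w) : v ∈ c.R u := by
  by_cases h : u.2 = w.2
  · obtain rfl : u = w := Prod.ext hw h
    exact hc.S_subset u hv
  · exact hc.mem_R_of_adj (cliquePath_adj.2 (Or.inl ⟨hw, h⟩)) hv

theorem Spread.notMem_R (h : Spread M p c) {u v : Fin N × Fin k} (hg : p + 3 ≤ gap u v) :
    v ∉ c.R u := by
  rw [h.valid.mem_R]
  rintro (rfl | ⟨w, hw, hv⟩)
  · simp [gap] at hg
  · refine h.far w v ?_ hv
    rcases cliquePath_adj_gap hw v with h1 | h1 <;> omega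

/-- By `far`, no node at this gap or beyond has sent the message, so it crossed from one clique
nearer. There `early` puts the sender in the layer of `v`, and matching edges preserve the layer. -/
theorem Spread.exists_of_mem_R (h : Spread M p c) {u v : Fin N × Fin k} (hg : gap u v = p + 2)
    (hv : v ∈ c.R u) : u.2 = v.2 ∧
      ∃ w, (cliquePath N k).Adj u w ∧ w.2 = u.2 ∧ gap w v = p + 1 ∧ v ∈ c.S w := by
  rcases (h.valid.mem_R u v).1 hv with rfl | ⟨w, hw, hv⟩
  · simp [gap] at hg
  · rcases cliquePath_adj_gap hw v with h1 | ⟨h1, h2 | h2⟩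
    · exact absurd hv (h.far w v (by omega))
    · exact absurd hv (h.far w v (by omega))
    · exact ⟨h1 ▸ h.early w v (by omega) hv, w, hw, h1, by omega, hv⟩

/-- The messages of cliques at distance `p + 1` have been received at most twice. -/
theorem Spread.cnt_le (h : Spread M p c) {u v : Fin N × Fin k} (hg : gap u v = p + 1) :
    c.cnt u v ≤ 2 := by
  classical
  have hne : v ≠ u := by rintro rfl; simp [gap] at hg
  obtain ⟨w₀, hw₀, -, hg₀⟩ := exists_toward (u := u) (v := v) (by omega)
  rw [h.valid.cnt_eq, if_neg hne, zero_add]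
  -- Only two neighbours can have sent `v`: the one nearer `v`, and the clique mate in the layer of
  -- `v`.
  refine (Finset.card_le_card (t := {w₀, (u.1, v.2)}) fun w hw => ?_).trans Finset.card_le_two
  obtain ⟨hw, hv⟩ := (Finset.mem_filter.1 hw).2
  rw [Finset.mem_insert, Finset.mem_singleton]
  rcases cliquePath_adj_gap hw v with h1 | ⟨h1, h2 | h2⟩
  · exact Or.inr (Prod.ext h1.1 (h.early w v (by omega) hv))
  · exact absurd hv (h.far w v (by omega))
  · exact Or.inl (toward_clique_unique hw hw₀ h2 hg₀)

/-- At most one clique on each side of `u` lies at gap `p + 1`, and `few` applies to each. -/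
theorem Spread.card_front_le (h : Spread M p c) (u : Fin N × Fin k) :
    ((c.R u).filter fun m => gap u m = p + 1).card ≤ 2 * M := by
  have aux : ∀ s ⊆ (c.R u).filter (fun m => gap u m = p + 1),
      (∀ m ∈ s, ∀ m' ∈ s, m.1 = m'.1) → s.card ≤ M := by
    intro s hs h1
    obtain rfl | ⟨v, hv⟩ := s.eq_empty_or_nonempty
    · simp
    · refine (Finset.card_le_card fun m hm => ?_).trans
        (h.few u v (Finset.mem_filter.1 (hs hv)).2)
      exact Finset.mem_filter.2 ⟨(Finset.mem_filter.1 (hs hm)).1, h1 m hm v hv⟩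
  rw [← Finset.card_filter_add_card_filter_not (fun m : Fin N × Fin k => m.1 ≤ u.1), two_mul]
  refine add_le_add (aux _ (Finset.filter_subset _ _) ?_) (aux _ (Finset.filter_subset _ _) ?_) <;>
  · intro m hm m' hm'
    have h1 := (Finset.mem_filter.1 (Finset.mem_filter.1 hm).1).2
    have h2 := (Finset.mem_filter.1 (Finset.mem_filter.1 hm').1).2
    have h3 := (Finset.mem_filter.1 hm).2
    have h4 := (Finset.mem_filter.1 hm').2
    unfold gap at h1 h2
    omega

/-- On each side both the clique and the layer of such a message are determined. -/
theorem Spread.card_early_le (h : Spread M p c) (u : Fin N × Fin k) :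
    ((c.R u).filter fun m => gap u m = p + 2).card ≤ 2 := by
  rw [← Finset.card_filter_add_card_filter_not (fun m : Fin N × Fin k => m.1 ≤ u.1),
    ← one_add_one_eq_two]
  refine add_le_add (Finset.card_le_one.2 ?_) (Finset.card_le_one.2 ?_) <;>
  · intro m hm m' hm'
    simp only [Finset.mem_filter] at hm hm'
    have h1 := (h.exists_of_mem_R hm.1.2 hm.1.1).1
    have h2 := (h.exists_of_mem_R hm'.1.2 hm'.1.1).1
    refine Prod.ext ?_ (h1.symm.trans h2)
    simp only [gap] at hm hm'
    omega

/-- The messages of cliques at distance `p + 1` are ranked first. -/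
theorem Spread.rank_le (h : Spread M p c) (tie : Fin N × Fin k ↪ ℕ) {u v : Fin N × Fin k}
    (hg : gap u v = p + 1) : rank (c.B u) (c.cnt u) tie v ≤ 2 * M + 2 := by
  have h2 := h.cnt_le hg
  refine (Finset.card_le_card (t := ((c.R u).filter fun m => gap u m = p + 1) ∪
    (c.R u).filter fun m => gap u m = p + 2) fun m hm => ?_).trans
    ((Finset.card_union_le _ _).trans (add_le_add (h.card_front_le u) (h.card_early_le u)))
  obtain ⟨hB, hm⟩ := Finset.mem_filter.1 hm
  obtain ⟨hR, hS⟩ := Finset.mem_sdiff.1 hB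
  simp only [Finset.mem_union, Finset.mem_filter, hR, true_and]
  -- A message ranked no later than `v` has counter at most 2, which excludes unsent old messages,
  -- whose counter is at least 3.
  by_contra hcon
  by_cases hp : gap u m ≤ p
  · have := (h.old u m hp).2 hS
    omega
  · exact h.notMem_R (by omega) hR

theorem Config.Valid.cnt_mono {V : Type*} [Fintype V] [DecidableEq V] {G : SimpleGraph V}
    {c c' : Config V} (hc : c.Valid G) (hc' : c'.Valid G) (hS : ∀ u, c.S u ⊆ c'.S u) (u v : V) :
    c.cnt u v ≤ c'.cnt u v := by
  classical
  rw [hc.cnt_eq, hc'.cnt_eq]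
  gcongr with w
  exact hS w

theorem Config.Valid.R_mono {V : Type*} [Fintype V] [DecidableEq V] {G : SimpleGraph V}
    {c c' : Config V} (hc : c.Valid G) (hc' : c'.Valid G) (hS : ∀ u, c.S u ⊆ c'.S u) (u : V) :
    c.R u ⊆ c'.R u := by
  intro v hv
  refine (hc'.mem_R u v).2 (((hc.mem_R u v).1 hv).imp_right ?_)
  rintro ⟨w, hw, hv⟩
  exact ⟨w, hw, hS w hv⟩

theorem Config.Valid.card_le_cnt {V : Type*} [Fintype V] [DecidableEq V] {G : SimpleGraph V}
    {c : Config V} (hc : c.Valid G) {u v : V} {s : Finset V}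
    (hs : ∀ w ∈ s, G.Adj u w ∧ v ∈ c.S w) : s.card ≤ c.cnt u v := by
  classical
  rw [hc.cnt_eq]
  refine le_add_left (Finset.card_le_card fun w hw => ?_)
  exact Finset.mem_filter.2 ⟨Finset.mem_univ w, hs w hw⟩

/-- A phase in which all nodes send the messages of cliques at distance `p + 1` they know advances
the information spreading. -/
theorem Spread.step (h : Spread M p c) {c' : Config (Fin N × Fin k)}
    (hv' : c'.Valid (cliquePath N k)) (hS : ∀ u, c.S u ⊆ c'.S u) (hS' : ∀ u, c'.S u ⊆ c.R u)
    (good : ∀ u v, gap u v = p + 1 → v ∈ c.R u → v ∈ c'.S u) : Spread M (p + 1) c' where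
  valid := hv'
  old u v hg := by
    by_cases hp : gap u v ≤ p
    · refine ⟨h.valid.R_mono hv' hS u (h.old u v hp).1, fun hv => ?_⟩
      exact ((h.old u v hp).2 fun hv' => hv (hS u hv')).trans (h.valid.cnt_mono hv' hS u v)
    have hg : gap u v = p + 1 := by omega
    by_cases hu : v ∈ c'.S u
    · exact ⟨hv'.S_subset u hu, fun h => absurd hu h⟩
    -- Three nodes of the clique of `u` knew `v` and have now sent it. Since `u` has not sent it,
    -- `u` is none of them and has heard all three.
    have hcnt : 3 ≤ c'.cnt u v := by
      refine (h.many u v hg).trans ?_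
      rw [← Finset.card_map ⟨fun a => (u.1, a), fun a b hab => (Prod.ext_iff.1 hab).2⟩]
      refine hv'.card_le_cnt fun w hw => ?_
      simp only [Finset.mem_map, Finset.mem_filter, Finset.mem_univ, true_and] at hw
      obtain ⟨a, ha, rfl⟩ := hw
      have hs := good (u.1, a) v hg ha
      refine ⟨cliquePath_adj.2 (Or.inl ⟨rfl, ?_⟩), hs⟩
      rintro rfl
      exact hu hs
    refine ⟨?_, fun _ => hcnt⟩
    obtain ⟨a, ha⟩ := Finset.card_pos.1 (lt_of_lt_of_le (by norm_num) (h.many u v hg))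
    exact hv'.mem_R_of_clique (w := (u.1, a)) rfl (good _ v hg (Finset.mem_filter.1 ha).2)
  early u v hg hv := (h.exists_of_mem_R hg (hS' u hv)).1
  far u v hg hv := h.notMem_R hg (hS' u hv)
  few u v hg := by
    obtain ⟨w, hw, hw2, hwg⟩ := exists_toward (u := u) (v := v) (by omega)
    refine (Finset.card_le_card fun m hm => ?_).trans (h.few w v (by omega))
    rw [Finset.mem_filter] at hm ⊢
    refine ⟨?_, hm.2⟩
    have hgm : ∀ x, gap x m = gap x v := fun x => by unfold gap; rw [hm.2]
    -- The sender `x` knew `m` before the phase. Either `x = w`, or `x` is in the clique of `u` and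
    -- got `m` from a node in the clique of `w`, whose sending informed `w` as well. So `w` already
    -- knew `m`, and the bound `M` passes from `w` to `u` without growing.
    rcases (hv'.mem_R u m).1 hm.1 with rfl | ⟨x, hx, hxm⟩
    · rw [← hgm] at hg; simp [gap] at hg
    have hxR := hS' x hxm
    rcases cliquePath_adj_gap hx m with h1 | ⟨h1, h2 | h2⟩
    · obtain ⟨-, y, hy, -, hyg, hyS⟩ := h.exists_of_mem_R (by rw [h1.2, hgm, hg]) hxR
      refine h.valid.mem_R_of_clique (w := y) ?_ hyS
      have e1 := hgm w
      have e2 := hgm u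
      have e3 := cliquePath_adj.1 hy
      have e4 := cliquePath_adj.1 hw
      have e5 := h1.1
      apply Fin.ext
      unfold gap at *
      omega
    · exact absurd hxR (h.notMem_R (by rw [h2, hgm]; omega))
    · obtain rfl := toward_clique_unique hx hw h2 (by rw [hgm, hgm, hwg])
      exact hxR
  many u v hg := by
    obtain ⟨w, hw, hw2, hwg⟩ := exists_toward (u := u) (v := v) (by omega)
    -- The nodes of the clique of `w` that know `v` all send it, and the matching carries it to the
    -- same layers in the clique of `u`.
    refine (h.many w v (by omega)).trans (Finset.card_le_card fun a ha => ?_)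
    rw [Finset.mem_filter] at ha ⊢
    refine ⟨Finset.mem_univ a, hv'.mem_R_of_adj (w := (w.1, a)) ?_ (good (w.1, a) v ?_ ha.2)⟩
    · rcases cliquePath_adj.1 hw with h1 | h1
      · exact absurd hw2.symm h1.2
      · exact cliquePath_adj.2 (Or.inr ⟨rfl, h1.2⟩)
    · change gap w v = p + 1
      omega

/-- The state of the information spreading after a random phase in which every message was sent by
three nodes of its clique, and few messages were sent across. -/
theorem spread_zero (hv : c.Valid (cliquePath N k)) {τ Y : ℕ} (hself : ∀ u, u ∈ c.S u)
    (hS : ∀ u v, v ∈ c.S u → v = u ∨ (cliquePath N k).Adj u v)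
    (hcard : ∀ u, (c.S u).card ≤ 1 + τ)
    (hmany : ∀ v, 3 ≤ (Finset.univ.filter fun a => v ∈ c.S (v.1, a)).card)
    (hfew : ∀ i j : Fin N, ((i : ℕ) + 1 = j ∨ (j : ℕ) + 1 = i) →
      (Finset.univ.filter fun b => (j, b) ∈ c.S (i, b)).card ≤ Y) :
    Spread (1 + τ + Y) 0 c where
  valid := hv
  old u v hg := by
    have hg : u.1 = v.1 := gap_eq_zero.1 (by omega)
    refine ⟨hv.mem_R_of_clique hg (hself v), fun hu => (hmany v).trans ?_⟩
    rw [← Finset.card_map ⟨fun a => (v.1, a), fun a b hab => (Prod.ext_iff.1 hab).2⟩]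
    refine hv.card_le_cnt fun w hw => ?_
    simp only [Finset.mem_map, Finset.mem_filter, Finset.mem_univ, true_and] at hw
    obtain ⟨a, ha, rfl⟩ := hw
    refine ⟨cliquePath_adj.2 (Or.inl ⟨hg, ?_⟩), ha⟩
    rintro rfl
    exact hu (by rwa [← hg] at ha)
  early u v hg hu := by
    rcases hS u v hu with rfl | h
    · rfl
    · rcases cliquePath_adj.1 h with h | h
      · rw [gap_eq_zero.2 h.1] at hg; omega
      · exact h.1
  far u v hg hu := by
    rcases hS u v hu with rfl | h
    · simp [gap] at hg
    · have := cliquePath_adj.1 h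
      unfold gap at hg
      omega
  few u v hg := by
    have hij : (u.1 : ℕ) + 1 = v.1 ∨ (v.1 : ℕ) + 1 = u.1 := by unfold gap at hg; omega
    -- A message of the clique of `v` reaches `u` either from its matching partner `(v.1, u.2)`,
    -- which sent at most `1 + τ` messages, or from a clique mate `(u.1, b)` that sent the message
    -- of its own partner `(v.1, b)`.
    refine (Finset.card_le_card (t := c.S (v.1, u.2) ∪
      (Finset.univ.filter fun b => (v.1, b) ∈ c.S (u.1, b)).map
        ⟨fun b => (v.1, b), fun a b hab => (Prod.ext_iff.1 hab).2⟩) fun m hm => ?_).trans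
      ((Finset.card_union_le _ _).trans (add_le_add (hcard _) ?_))
    swap
    · rw [Finset.card_map]
      exact hfew u.1 v.1 hij
    rw [Finset.mem_filter] at hm
    obtain ⟨hm, hm1⟩ := hm
    obtain ⟨m1, b⟩ := m
    obtain rfl : m1 = v.1 := hm1
    simp only [Finset.mem_union, Finset.mem_map, Finset.mem_filter, Finset.mem_univ, true_and]
    rcases (hv.mem_R u _).1 hm with h | ⟨w, hw, hwS⟩
    · rw [← h] at hij; simp at hij
    have hw1 := cliquePath_adj.1 hw
    rcases hS w _ hwS with h | h
    · left
      rcases hw1 with h1 | h1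
      · have := congrArg Prod.fst h
        simp only at this
        have := h1.1
        omega
      · have : b = w.2 := congrArg Prod.snd h
        rw [h1.1, ← this]
        rwa [← h] at hwS
    · have h2 := cliquePath_adj.1 h
      simp only at h2
      rcases hw1 with h1 | h1
      · right
        refine ⟨b, ?_, rfl⟩
        have : w = (u.1, b) := Prod.ext h1.1.symm (by
          rcases h2 with h2 | h2
          · have := h2.1; have := h1.1; omega
          · exact h2.1)
        rwa [← this]
      · left
        have : w = (v.1, u.2) := Prod.ext (Fin.ext (by simp only; omega)) h1.1.symm
        rwa [← this]
  many u v hg := by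
    have hij : (u.1 : ℕ) + 1 = v.1 ∨ (v.1 : ℕ) + 1 = u.1 := by unfold gap at hg; omega
    refine (hmany v).trans (Finset.card_le_card fun a ha => ?_)
    rw [Finset.mem_filter] at ha ⊢
    exact ⟨Finset.mem_univ a,
      hv.mem_R_of_adj (w := (v.1, a)) (cliquePath_adj.2 (Or.inr ⟨rfl, hij⟩)) ha.2⟩

end CliquePath
-- Union bounds.
section Union

variable {α β : Type*}

/-- The cover is required only on the support, so that invariants of reachable configurations can be
used to establish it. -/
theorem toOuterMeasure_le_card_mul {ι : Type*} [Fintype ι] (p : PMF α) {s : Set α}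
    {A : ι → Set α} (hs : ∀ a ∈ p.support, a ∈ s → ∃ i, a ∈ A i) {ε : ℝ≥0∞}
    (hA : ∀ i, p.toOuterMeasure (A i) ≤ ε) : p.toOuterMeasure s ≤ Fintype.card ι * ε := by
  classical
  calc p.toOuterMeasure s ≤ expect p fun a => ∑ i, if a ∈ A i then 1 else 0 := by
        rw [toOuterMeasure_eq_expect]
        refine expect_mono fun a ha => ?_
        split_ifs with h
        · obtain ⟨i, hi⟩ := hs a ha h
          exact (by simp [hi] : (1 : ℝ≥0∞) ≤ if a ∈ A i then 1 else 0).trans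
            (Finset.single_le_sum (f := fun i => if a ∈ A i then (1 : ℝ≥0∞) else 0)
              (fun _ _ => zero_le) (Finset.mem_univ i))
        · exact zero_le
    _ ≤ ∑ _i : ι, ε := by
        rw [expect_sum]
        refine Finset.sum_le_sum fun i _ => ?_
        rw [← toOuterMeasure_eq_expect]
        exact hA i
    _ = _ := by simp

theorem toOuterMeasure_bind_le (p : PMF α) (q : α → PMF β) (good : Set α) (s : Set β)
    {ε : ℝ≥0∞} (h : ∀ a ∈ good, (q a).toOuterMeasure s ≤ ε) :
    (p.bind q).toOuterMeasure s ≤ p.toOuterMeasure goodᶜ + ε := by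
  classical
  rw [toOuterMeasure_eq_expect, expect_bind]
  calc _ ≤ expect p fun a => (if a ∈ goodᶜ then 1 else 0) + ε := by
        refine expect_mono fun a _ => ?_
        by_cases ha : a ∈ good
        · rw [← toOuterMeasure_eq_expect]
          exact (h a ha).trans le_add_self
        · rw [if_pos (show a ∈ goodᶜ from ha)]
          refine le_trans ?_ le_self_add
          refine (expect_mono (g := fun _ => 1) fun b _ => ?_).trans (expect_const _ _).le
          split_ifs
          exacts [le_rfl, zero_le]
    _ = _ := by
        rw [expect_add, expect_const, toOuterMeasure_eq_expect]
        congr!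

theorem toOuterMeasure_add_compl (p : PMF α) (s : Set α) :
    p.toOuterMeasure s + p.toOuterMeasure sᶜ = 1 := by
  classical
  rw [toOuterMeasure_eq_expect, toOuterMeasure_eq_expect, ← expect_add, ← expect_const p 1]
  congr 1
  ext a
  by_cases h : a ∈ s <;> simp [h, expect_const]

end Union

/-! ### One ranking phase. -/

section RankingPhase

variable {N k M p : ℕ} {c : Config (Fin N × Fin k)}

theorem Config.Valid.startRanking {V : Type*} [Fintype V] [DecidableEq V] {G : SimpleGraph V}
    {c : Config V} (hc : c.Valid G) (tie : V → V ↪ ℕ) : (c.startRanking tie).Valid G :=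
  ⟨hc.mem_R, hc.cnt_eq, hc.S_subset⟩

theorem Config.Valid.startRandom {V : Type*} [Fintype V] [DecidableEq V] {G : SimpleGraph V}
    {c : Config V} (hc : c.Valid G) : c.startRandom.Valid G :=
  ⟨hc.mem_R, hc.cnt_eq, hc.S_subset⟩

/-- A ranking phase advances the information spreading with high probability. -/
theorem Spread.rankingPhase_le (h : Spread M p c) (tie : Fin N × Fin k → (Fin N × Fin k) ↪ ℕ)
    {r H : ℝ} (hr : (2 * M + 2 : ℕ) ≤ r) (hH : ∀ b ≤ N * k, (harmonic b : ℝ) ≤ H) (hH0 : 0 < H)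
    (T : ℕ) :
    (phaseRounds (cliquePath N k) T (c.startRanking tie)).toOuterMeasure
      {c' | Spread M (p + 1) c' ∧ c'.t = c.t + T}ᶜ ≤
      ((N * k : ℕ) : ℝ≥0∞) ^ 2 * ENNReal.ofReal (Real.exp (-(1 / (r * H) * T))) := by
  classical
  have hv := h.valid.startRanking tie
  have hr0 : 0 < r := lt_of_lt_of_le (by positivity) hr
  have hcard : ((N * k : ℕ) : ℝ≥0∞) ^ 2 =
      Fintype.card ((Fin N × Fin k) × (Fin N × Fin k)) := by
    simp [sq]
  rw [hcard]
  refine toOuterMeasure_le_card_mul _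
    -- The bad events are indexed by pairs (node, message): an unsent frontier message stays in the
    -- buffer for the whole phase. Other pairs contribute the empty event.
    (A := fun i => if gap i.1 i.2 = p + 1 ∧ i.2 ∈ c.B i.1 then
      {c' | ∀ u ∈ ({i.1} : Finset _), i.2 ∈ c'.Bhat u} else ∅) ?_ ?_
  · intro c' hc' hbad
    have hin := InPhase.of_mem_support_phaseRounds hv T 0
      (InPhase.start hv rfl) hc'
    by_contra! hno
    refine hbad ⟨h.step hin.valid hin.S_mono hin.S_subset fun u v hg hvR => ?_, ?_⟩
    · by_contra hvS
      have hB : v ∈ c.B u := Finset.mem_sdiff.2 ⟨hvR, fun hs => hvS (hin.S_mono u hs)⟩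
      refine hno (u, v) ?_
      rw [if_pos ⟨hg, hB⟩]
      simp only [Set.mem_ofPred_eq, Finset.mem_singleton, forall_eq, hin.Bhat_eq]
      exact Finset.mem_sdiff.2 ⟨hB, hvS⟩
    · rw [hin.t_eq, zero_add]
      rfl
  · rintro ⟨u, v⟩
    by_cases hi : gap u v = p + 1 ∧ v ∈ c.B u
    swap
    · simp only [hi, if_false]
      simp
    simp only [hi, and_self, if_true]
    refine (phaseRounds_keep_le hv rfl T {u} v (1 / (r * H)) ?_).trans ?_
    · intro j c' hc' u' hu' hm
      obtain rfl := Finset.mem_singleton.1 hu'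
      have hle : ENNReal.ofReal (1 / (r * H)) ≤ (c.startRanking tie).Prob u' v := by
        refine le_rankingFunction hi.2 (le_trans ?_ hr) (hH _ ?_)
        · exact_mod_cast h.rank_le (tie u') hi.1
        · refine (Finset.card_le_univ _).trans ?_
          simp
      refine hle.trans (le_popDist ?_ hm ?_)
      · refine le_trans (Finset.sum_le_sum_of_subset (t := c.B u') ?_)
          (sum_rankingFunction_le _ (c.cnt u') (tie u'))
        rw [hc'.Bhat_eq]
        exact Finset.sdiff_subset
      · refine (lt_of_lt_of_le ?_ hle).ne'
        rw [ENNReal.ofReal_pos]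
        positivity
    · simp

end RankingPhase

/-! ### The random phase. -/

section RandomPhase

variable {N k : ℕ}

/-- The start of the random phase. -/
noncomputable def randomStart {V : Type*} [Fintype V] [DecidableEq V] (G : SimpleGraph V) :
    Config V :=
  (Config.init.syncRound G fun u => some u).startRandom

section General

variable {V : Type*} [Fintype V] [DecidableEq V] (G : SimpleGraph V)

theorem randomStart_valid : (randomStart G).Valid G :=
  ((Config.valid_init G).syncRound fun u v h => by
    obtain rfl : u = v := by simpa using h
    simp [Config.B, Config.init]).startRandom

theorem randomStart_S (u : V) : (randomStart G).S u = {u} := by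
  simp [randomStart, Config.startRandom, Config.syncRound, Config.init]

theorem mem_randomStart_R {u v : V} : v ∈ (randomStart G).R u ↔ v = u ∨ G.Adj u v := by
  rw [(randomStart_valid G).mem_R]
  simp [randomStart_S]

theorem mem_randomStart_B {u v : V} : v ∈ (randomStart G).B u ↔ G.Adj u v := by
  rw [Config.B, Finset.mem_sdiff, mem_randomStart_R, randomStart_S, Finset.mem_singleton]
  constructor
  · rintro ⟨h1, h2⟩
    exact h1.resolve_left h2
  · exact fun h => ⟨Or.inr h, h.ne'⟩

variable {G}

theorem InPhase.popDist_random {c : Config V} {j : ℕ} (h : InPhase G (randomStart G) j c) {u m : V}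
    (hm : m ∈ c.Bhat u) :
    popDist (c.Bhat u) ((randomStart G).Prob u) (some m) = ((c.Bhat u).card : ℝ≥0∞)⁻¹ := by
  have hsub : c.Bhat u ⊆ (randomStart G).B u := by
    rw [h.Bhat_eq]; exact Finset.sdiff_subset
  have hne : ((randomStart G).B u).card ≠ 0 := Finset.card_ne_zero_of_mem (hsub hm)
  refine popDist_uniform (x := (((randomStart G).B u).card : ℝ≥0∞)⁻¹) ?_ ?_ ?_ hm
  · simp
  · simpa [Finset.card_eq_zero] using hne
  · exact fun m hm => if_pos (hsub hm)

end General

theorem card_randomStart_B_le (u : Fin N × Fin k) :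
    ((randomStart (cliquePath N k)).B u).card ≤ k + 2 := by
  have h1 : ((randomStart (cliquePath N k)).B u).filter (fun v => v.1 = u.1) ⊆
      Finset.univ.map ⟨fun a => (u.1, a), fun a b hab => (Prod.ext_iff.1 hab).2⟩ := by
    rintro ⟨i, a⟩ hv
    obtain rfl : i = u.1 := (Finset.mem_filter.1 hv).2
    exact Finset.mem_map.2 ⟨a, Finset.mem_univ a, rfl⟩
  have h2 := Finset.card_le_card h1
  rw [Finset.card_map, Finset.card_univ, Fintype.card_fin] at h2
  rw [← Finset.card_filter_add_card_filter_not (fun v : Fin N × Fin k => v.1 = u.1)]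
  refine add_le_add h2 ?_
  rw [← Finset.card_filter_add_card_filter_not (fun v : Fin N × Fin k => v.1 ≤ u.1),
    ← one_add_one_eq_two]
  refine add_le_add (Finset.card_le_one.2 ?_) (Finset.card_le_one.2 ?_) <;>
  · intro m hm m' hm'
    simp only [Finset.mem_filter, mem_randomStart_B, cliquePath_adj] at hm hm'
    refine Prod.ext ?_ ?_
    · omega
    · rcases hm.1.1 with h | h
      · exact absurd h.1.symm hm.1.2
      rcases hm'.1.1 with h' | h'
      · exact absurd h'.1.symm hm'.1.2
      exact h.1.symm.trans h'.1

theorem le_card_randomStart_B (u : Fin N × Fin k) :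
    k ≤ ((randomStart (cliquePath N k)).B u).card + 1 := by
  have h1 : (Finset.univ.erase u.2).map
      ⟨fun a => (u.1, a), fun a b hab => (Prod.ext_iff.1 hab).2⟩ ⊆
      (randomStart (cliquePath N k)).B u := by
    intro v hv
    simp only [Finset.mem_map, Finset.mem_erase, Finset.mem_univ, and_true] at hv
    obtain ⟨a, ha, rfl⟩ := hv
    exact (mem_randomStart_B _).2 (cliquePath_adj.2 (Or.inl ⟨rfl, ha.symm⟩))
  have h2 := Finset.card_le_card h1
  rw [Finset.card_map, Finset.card_erase_of_mem (Finset.mem_univ _), Finset.card_univ,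
    Fintype.card_fin] at h2
  omega

/-- Apart from any given node, some other node of its clique sends a given message in the random
phase. -/
theorem randomPhase_keep_le (hk : 6 ≤ k) (τ : ℕ) (v : Fin N × Fin k) (a₀ : Fin k) :
    (phaseRounds (cliquePath N k) τ (randomStart (cliquePath N k))).toOuterMeasure
      {c | ∀ a, a ≠ v.2 → a ≠ a₀ → v ∉ c.S (v.1, a)} ≤
      ENNReal.ofReal (Real.exp (-(τ / 4 : ℝ))) := by
  set W : Finset (Fin N × Fin k) := ((Finset.univ.erase v.2).erase a₀).map
    ⟨fun a => (v.1, a), fun a b hab => (Prod.ext_iff.1 hab).2⟩ with hW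
  have hWcard : k ≤ W.card + 2 := by
    have h1 := Finset.pred_card_le_card_erase (s := Finset.univ.erase v.2) (a := a₀)
    have h2 := Finset.pred_card_le_card_erase (s := Finset.univ) (a := v.2)
    rw [Finset.card_univ, Fintype.card_fin] at h2
    rw [hW, Finset.card_map]
    omega
  have hmem : ∀ w ∈ W, ∃ a, a ≠ v.2 ∧ a ≠ a₀ ∧ w = (v.1, a) := by
    intro w hw
    simp only [hW, Finset.mem_map, Finset.mem_erase, Finset.mem_univ, and_true] at hw
    obtain ⟨a, ha, rfl⟩ := hw
    exact ⟨a, ha.2, ha.1, rfl⟩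
  have hv := randomStart_valid (cliquePath N k)
  have key := phaseRounds_keep_le hv rfl τ W v (1 / ((k : ℝ) + 2)) (by
    intro j c hc u hu hm
    rw [hc.popDist_random hm, one_div, ENNReal.ofReal_inv_of_pos (by positivity)]
    refine ENNReal.inv_le_inv.2 ?_
    rw [← ENNReal.ofReal_natCast]
    refine ENNReal.ofReal_le_ofReal ?_
    have : (c.Bhat u).card ≤ k + 2 := by
      refine (Finset.card_le_card ?_).trans (card_randomStart_B_le u)
      rw [hc.Bhat_eq]; exact Finset.sdiff_subset
    exact_mod_cast this)
  refine (PMF.toOuterMeasure_mono _ ?_).trans (key.trans (ENNReal.ofReal_le_ofReal ?_))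
  · rintro c ⟨hc, hcs⟩ w hw
    obtain ⟨a, ha, ha0, rfl⟩ := hmem w hw
    have hin := InPhase.of_mem_support_phaseRounds hv τ 0 (InPhase.start hv rfl) hcs
    rw [hin.Bhat_eq]
    refine Finset.mem_sdiff.2 ⟨?_, hc a ha ha0⟩
    exact (mem_randomStart_B _).2 (cliquePath_adj.2 (Or.inl ⟨rfl, ha⟩))
  · refine Real.exp_le_exp.2 (neg_le_neg ?_)
    have h1 : (k : ℝ) ≤ W.card + 2 := by exact_mod_cast hWcard
    have h2 : (6 : ℝ) ≤ k := by exact_mod_cast hk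
    -- At least `k - 2` nodes pop `v` with probability at least `1 / (k + 2)` each, and `(k - 2) /
    -- (k + 2) ≥ 1 / 4` for `k ≥ 6`.
    have h3 : (1 / 4 : ℝ) ≤ 1 / ((k : ℝ) + 2) * W.card := by
      rw [one_div_mul_eq_div, le_div_iff₀ (by positivity)]
      linarith
    calc (τ / 4 : ℝ) = 1 / 4 * τ := by ring
      _ ≤ _ := by gcongr

/-- Few nodes of a clique send the message of their neighbour in an adjacent clique in the random
phase. -/
theorem randomPhase_cross_le {τ : ℕ} (hk : 9 * (τ + 1) ≤ k) (i j : Fin N)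
    (hij : (i : ℕ) + 1 = j ∨ (j : ℕ) + 1 = i) :
    (phaseRounds (cliquePath N k) τ (randomStart (cliquePath N k))).toOuterMeasure
      {c | 2 * τ + 1 ≤ (Finset.univ.filter fun b => (j, b) ∈ c.S (i, b)).card} ≤
      ENNReal.ofReal (Real.exp (-(τ / 4 : ℝ))) := by
  have hv := randomStart_valid (cliquePath N k)
  set e : Fin k ↪ Fin N × Fin k := ⟨fun a => (i, a), fun a b hab => (Prod.ext_iff.1 hab).2⟩
  have hkr : (9 : ℝ) * (τ + 1) ≤ k := by exact_mod_cast hk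
  have hτ : (0 : ℝ) ≤ τ := τ.cast_nonneg
  have hpos : (0 : ℝ) < (k : ℝ) - 1 - τ := by linarith
  have key := phaseRounds_many_le hv rfl τ (Finset.univ.map e) (fun u => (j, u.2)) (by
      intro u hu
      obtain ⟨b, -, rfl⟩ := Finset.mem_map.1 hu
      exact (mem_randomStart_B _).2 (cliquePath_adj.2 (Or.inr ⟨rfl, hij⟩)))
    -- The buffer starts with at least `k - 1` messages, and before each round of the phase at most
    -- `τ` messages have been sent, including the one of round 0.
    (q := 1 / ((k : ℝ) - 1 - τ)) (by positivity) (by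
      intro l hl c hc u hu hm
      rw [hc.popDist_random hm, one_div, ENNReal.ofReal_inv_of_pos hpos]
      refine ENNReal.inv_le_inv.2 ?_
      rw [← ENNReal.ofReal_natCast]
      refine ENNReal.ofReal_le_ofReal ?_
      have h1 := le_card_randomStart_B u
      have h2 := hc.card_S_le u
      rw [randomStart_S, Finset.card_singleton] at h2
      have h3 := Finset.le_card_sdiff (c.S u) ((randomStart (cliquePath N k)).B u)
      rw [← hc.Bhat_eq] at h3
      have h4 : k ≤ (c.Bhat u).card + 1 + τ := by omega
      have h5 : (k : ℝ) ≤ (c.Bhat u).card + 1 + τ := by exact_mod_cast h4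
      linarith) (2 * τ + 1)
  have hset : ∀ c : Config (Fin N × Fin k),
      ((Finset.univ.map e).filter fun u => (j, u.2) ∈ c.S u).card =
      (Finset.univ.filter fun b => (j, b) ∈ c.S (i, b)).card := by
    intro c
    rw [Finset.filter_map, Finset.card_map]
    rfl
  simp only [hset] at key
  refine key.trans ?_
  rw [Finset.card_map, Finset.card_univ, Fintype.card_fin]
  have h2 : (2 : ℝ≥0∞) ^ (2 * τ + 1) = ENNReal.ofReal (2 ^ (2 * τ + 1)) := by
    rw [ENNReal.ofReal_pow zero_le_two, ENNReal.ofReal_ofNat]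
  rw [h2, ← ENNReal.ofReal_div_of_pos (by positivity)]
  refine ENNReal.ofReal_le_ofReal ((div_le_iff₀ (by positivity)).2 ?_)
  -- From `9 * (τ + 1) ≤ k`. The target follows since `9/8 + 1/4 = 11/8` and `exp (11/16) ≤ 2`, as
  -- `11/16 < log 2`.
  have h3 : (1 / ((k : ℝ) - 1 - τ)) * k ≤ 9 / 8 := by
    rw [one_div_mul_eq_div, div_le_iff₀ hpos]
    linarith
  have h4 : Real.exp (11 / 8 * τ) ≤ 2 ^ (2 * τ + 1) := by
    have h5 : Real.exp (11 / 16) ≤ 2 := by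
      rw [← Real.le_log_iff_exp_le two_pos]
      linarith [Real.log_two_gt_d9]
    calc Real.exp (11 / 8 * τ) = Real.exp (11 / 16) ^ (2 * τ) := by
          rw [← Real.exp_nat_mul]; congr 1; push_cast; ring
      _ ≤ 2 ^ (2 * τ) := by gcongr
      _ ≤ 2 ^ (2 * τ + 1) := pow_le_pow_right₀ one_le_two (by omega)
  calc Real.exp (1 / ((k : ℝ) - 1 - τ) * k * τ) ≤ Real.exp (9 / 8 * τ) := by gcongr
    _ = Real.exp (-(τ / 4 : ℝ)) * Real.exp (11 / 8 * τ) := by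
        rw [← Real.exp_add]; congr 1; ring
    _ ≤ _ := by gcongr

/-- The random phase prepares the information spreading with high probability. -/
theorem randomPhase_le {τ : ℕ} (hk : 9 * (τ + 1) ≤ k) :
    (phaseRounds (cliquePath N k) τ (randomStart (cliquePath N k))).toOuterMeasure
      {c | Spread (1 + τ + 2 * τ) 0 c ∧ c.t = 1 + τ}ᶜ ≤
      2 * ((N * k : ℕ) : ℝ≥0∞) ^ 2 * ENNReal.ofReal (Real.exp (-(τ / 4 : ℝ))) := by
  classical
  have hv := randomStart_valid (cliquePath N k)
  have hcard : (Fintype.card (((Fin N × Fin k) × Fin k) ⊕ (Fin N × Fin N)) : ℝ≥0∞) ≤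
      2 * ((N * k : ℕ) : ℝ≥0∞) ^ 2 := by
    have : Fintype.card (((Fin N × Fin k) × Fin k) ⊕ (Fin N × Fin N)) ≤ 2 * (N * k) ^ 2 := by
      simp only [Fintype.card_sum, Fintype.card_prod, Fintype.card_fin]
      have hk1 : 1 ≤ k := by omega
      have h1 : N * k * k ≤ (N * k) ^ 2 := by
        rw [sq]
        rcases N.eq_zero_or_pos with rfl | hN
        · simp
        · exact Nat.mul_le_mul_left _ (Nat.le_mul_of_pos_left k hN)
      have h2 : N * N ≤ (N * k) ^ 2 := by
        rw [sq]
        gcongr <;> exact Nat.le_mul_of_pos_right N hk1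
      omega
    exact_mod_cast this
  refine le_trans ?_ (mul_le_mul_left hcard _)
  refine toOuterMeasure_le_card_mul _ (A := Sum.elim
    (fun i => {c | ∀ a, a ≠ i.1.2 → a ≠ i.2 → i.1 ∉ c.S (i.1.1, a)})
    (fun i => if ((i.1 : ℕ) + 1 = i.2 ∨ (i.2 : ℕ) + 1 = i.1) then
      {c | 2 * τ + 1 ≤ (Finset.univ.filter fun b => (i.2, b) ∈ c.S (i.1, b)).card} else ∅)) ?_ ?_
  · intro c hcs hbad
    have hin := InPhase.of_mem_support_phaseRounds hv τ 0 (InPhase.start hv rfl) hcs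
    by_contra! hno
    refine hbad ⟨spread_zero hin.valid ?_ ?_ ?_ ?_ ?_, ?_⟩
    · intro u
      exact hin.S_mono u (by simp [randomStart_S])
    · intro u v h
      exact (mem_randomStart_R _).1 (hin.S_subset u h)
    · intro u
      have := hin.card_S_le u
      rwa [randomStart_S, Finset.card_singleton, zero_add] at this
    · intro v
      -- The excluded node is used twice: excluding `v.2` gives a second sender `a`, then excluding
      -- `a` gives a third sender `b`; the origin itself sent in round 0.
      have h1 := hno (Sum.inl (v, v.2))
      simp only [Sum.elim_inl, Set.mem_ofPred_eq, not_forall, not_not] at h1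
      obtain ⟨a, ha, -, haS⟩ := h1
      have h2 := hno (Sum.inl (v, a))
      simp only [Sum.elim_inl, Set.mem_ofPred_eq, not_forall, not_not] at h2
      obtain ⟨b, hb, hba, hbS⟩ := h2
      have h3 : ({v.2, a, b} : Finset (Fin k)).card = 3 :=
        Finset.card_eq_three.2 ⟨v.2, a, b, ha.symm, hb.symm, hba.symm, rfl⟩
      rw [← h3]
      refine Finset.card_le_card fun x hx => ?_
      rw [Finset.mem_filter]
      refine ⟨Finset.mem_univ x, ?_⟩
      simp only [Finset.mem_insert, Finset.mem_singleton] at hx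
      rcases hx with rfl | rfl | rfl
      · exact hin.S_mono v (by simp [randomStart_S])
      · exact haS
      · exact hbS
    · intro i j hij
      have h1 := hno (Sum.inr (i, j))
      simp only [Sum.elim_inr, hij, if_true, Set.mem_ofPred_eq] at h1
      omega
    · rw [hin.t_eq, zero_add]
      rfl
  · rintro (⟨v, a⟩ | ⟨i, j⟩)
    · exact randomPhase_keep_le (by omega) τ v a
    · by_cases hij : (i : ℕ) + 1 = j ∨ (j : ℕ) + 1 = i
      · simp only [Sum.elim_inr, hij, if_true]
        exact randomPhase_cross_le hk i j hij
      · simp only [Sum.elim_inr, hij, if_false]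
        simp

end RandomPhase

/-! ### The whole execution and the choice of constants. -/

/-- The basic algorithm on a row of cliques spreads the information by one clique in each ranking
phase with high probability. -/
theorem basicAlgorithm_le {N k τ τ' : ℕ} (hk : 9 * (τ + 1) ≤ k) {r H : ℝ}
    (hr : (2 * (1 + τ + 2 * τ) + 2 : ℕ) ≤ r) (hH : ∀ b ≤ N * k, (harmonic b : ℝ) ≤ H)
    (hH0 : 0 < H)
    (tie : Config (Fin N × Fin k) → Fin N × Fin k → (Fin N × Fin k) ↪ ℕ) (p : ℕ) :
    (basicAlgorithm (cliquePath N k) τ τ' tie p).toOuterMeasure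
      {c | Spread (1 + τ + 2 * τ) p c ∧ c.t = 1 + τ + p * τ'}ᶜ ≤
      2 * ((N * k : ℕ) : ℝ≥0∞) ^ 2 * ENNReal.ofReal (Real.exp (-(τ / 4 : ℝ))) +
        p * (((N * k : ℕ) : ℝ≥0∞) ^ 2 *
          ENNReal.ofReal (Real.exp (-(1 / (r * H) * τ')))) := by
  induction p with
  | zero => simpa [basicAlgorithm, randomStart] using randomPhase_le hk
  | succ p ih =>
    rw [basicAlgorithm]
    refine (toOuterMeasure_bind_le _ _
      {c | Spread (1 + τ + 2 * τ) p c ∧ c.t = 1 + τ + p * τ'} _ (ε := ((N * k : ℕ) : ℝ≥0∞) ^ 2 *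
        ENNReal.ofReal (Real.exp (-(1 / (r * H) * τ')))) fun c hc => ?_).trans
      ((add_le_add_left ih _).trans (le_of_eq ?_))
    · have := hc.1.rankingPhase_le (tie c) hr hH hH0 τ'
      rwa [hc.2, add_assoc (1 + τ), ← Nat.succ_mul] at this
    · push_cast
      ring

theorem one_sub_le_toReal_toOuterMeasure {α : Type*} {p : PMF α} {good s : Set α} {x : ℝ}
    (hx : 0 ≤ x) (h : p.toOuterMeasure goodᶜ ≤ ENNReal.ofReal x) (hs : good ⊆ s) :
    1 - x ≤ (p.toOuterMeasure s).toReal := by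
  have htop : ∀ s, p.toOuterMeasure s ≠ ∞ := fun s => by
    refine ne_top_of_le_ne_top ENNReal.one_ne_top ?_
    rw [← toOuterMeasure_add_compl p s]
    exact le_self_add
  refine le_trans ?_ (ENNReal.toReal_mono (htop _) (MeasureTheory.measure_mono hs))
  have h1 := congrArg ENNReal.toReal (toOuterMeasure_add_compl p good)
  rw [ENNReal.toReal_add (htop _) (htop _), ENNReal.toReal_one] at h1
  have h2 := ENNReal.toReal_mono ENNReal.ofReal_ne_top h
  rw [ENNReal.toReal_ofReal hx] at h2
  linarith

/-- The exponent `c + 4` absorbs `n ^ 2` pairs in each of the `N` phases, because `2 + N ≤ n ^ 2`.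
-/
theorem union_bound_le {n N : ℕ} {c x y : ℝ} (hn : 3 ≤ n) (hN : N ≤ n)
    (hx : x ≤ (n : ℝ) ^ (-(c + 4))) (hy : y ≤ (n : ℝ) ^ (-(c + 4))) :
    2 * (n : ℝ≥0∞) ^ 2 * ENNReal.ofReal x + N * ((n : ℝ≥0∞) ^ 2 * ENNReal.ofReal y) ≤
      ENNReal.ofReal (1 / (n : ℝ) ^ c) := by
  have hn' : (3 : ℝ) ≤ n := by exact_mod_cast hn
  have hN' : (N : ℝ) ≤ n := by exact_mod_cast hN
  have hn0 : (0 : ℝ) < n := by linarith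
  calc _ ≤ 2 * (n : ℝ≥0∞) ^ 2 * ENNReal.ofReal ((n : ℝ) ^ (-(c + 4))) +
        N * ((n : ℝ≥0∞) ^ 2 * ENNReal.ofReal ((n : ℝ) ^ (-(c + 4)))) := by gcongr
    _ = ENNReal.ofReal ((2 * (n : ℝ) ^ 2 + N * (n : ℝ) ^ 2) * (n : ℝ) ^ (-(c + 4))) := by
        rw [ENNReal.ofReal_mul (by positivity), ENNReal.ofReal_add (by positivity) (by positivity),
          ENNReal.ofReal_mul (by positivity), ENNReal.ofReal_mul (by positivity),
          ENNReal.ofReal_pow (by positivity), ENNReal.ofReal_natCast, ENNReal.ofReal_natCast,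
          ENNReal.ofReal_ofNat]
        ring
    _ ≤ _ := by
        refine ENNReal.ofReal_le_ofReal ?_
        rw [neg_add, Real.rpow_add hn0, Real.rpow_neg hn0.le c, one_div, mul_left_comm]
        refine mul_le_of_le_one_right (by positivity) ?_
        rw [Real.rpow_neg hn0.le, ← div_eq_mul_inv, div_le_one (by positivity),
          Real.rpow_ofNat, ← add_mul]
        have h1 : (n : ℝ) ^ 4 = n ^ 2 * n ^ 2 := by ring
        rw [h1]
        gcongr
        nlinarith

theorem rounds_le {α d L τ τ' N : ℝ} (hα : 0 ≤ α) (hd : 0 ≤ d) (hL : 1 ≤ L) (hN : 1 ≤ N)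
    (hτ : τ ≤ α * L + 1) (hτ' : τ' ≤ 8 * d * τ * L ^ 2 + 1) :
    1 + τ + N * τ' ≤ (8 * d * (α + 1) + 1 + (α + 2)) * (N * L ^ 3) := by
  have h0 : 1 ≤ L ^ 3 := one_le_pow₀ hL
  have hLL : L ≤ L ^ 3 := le_self_pow₀ hL (by norm_num)
  have h1 : 1 + τ ≤ (α + 2) * (N * L ^ 3) := by
    calc 1 + τ ≤ (α + 2) * L := by linarith
      _ ≤ (α + 2) * (1 * L ^ 3) := by rw [one_mul]; gcongr
      _ ≤ _ := by gcongr
  have h2 : τ' ≤ (8 * d * (α + 1) + 1) * L ^ 3 := by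
    have h3 : 8 * d * τ * L ^ 2 ≤ 8 * d * ((α + 1) * L) * L ^ 2 := by
      gcongr
      linarith
    calc τ' ≤ 8 * d * ((α + 1) * L) * L ^ 2 + 1 := by linarith
      _ = 8 * d * (α + 1) * L ^ 3 + 1 := by ring
      _ ≤ _ := by linarith
  have h3 : N * τ' ≤ N * ((8 * d * (α + 1) + 1) * L ^ 3) := by gcongr
  linarith

end VertexCongest

open VertexCongest
theorem mainTheorem2 (c α d : ℝ) (hc : 1 ≤ c) (hα : 48 * c + 96 < α) (hd : c + 3 < d) :
    ∃ C : ℝ, ∀ k : ℕ → ℕ,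
      (fun n : ℕ => Real.logb 2 n ^ 3) =o[Filter.atTop] (fun n : ℕ => (k n : ℝ)) →
      ∀ᶠ n : ℕ in Filter.atTop, k n ∣ n →
        ∀ tie : Config (Fin (n / k n) × Fin (k n)) →
            Fin (n / k n) × Fin (k n) → (Fin (n / k n) × Fin (k n)) ↪ ℕ,
          1 - 1 / (n : ℝ) ^ c ≤
            ((basicAlgorithm (graphNK n (k n)) (randomPhaseLength α n) (rankingPhaseLength α d n)
                tie (n / k n)).toOuterMeasure
              {s | s.FullSpreading ∧
                (s.t : ℝ) ≤ C * ((n : ℝ) * Real.logb 2 n ^ 3 / (k n : ℝ))}).toReal := by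
  refine ⟨8 * d * (α + 1) + 1 + (α + 2), fun k hk => ?_⟩
  have hα0 : 0 < α := by linarith
  have hd0 : 0 < d := by linarith
  -- This constant gives `9 * (τ + 1) ≤ k n`, because `τ + 1 ≤ α * L + 2 ≤ (α + 2) * L ^ 3`. The
  -- bound `n ≥ 16` gives `L ≥ 4`.
  filter_upwards [hk.def (c := 1 / (9 * (α + 2))) (by positivity),
    Filter.eventually_ge_atTop 16] with n hkn hn hdvd
  set L := Real.logb 2 n with hL
  set τ := randomPhaseLength α n with hτ
  set τ' := rankingPhaseLength α d n with hτ'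
  have hn' : (16 : ℝ) ≤ n := by exact_mod_cast hn
  have hn0 : (0 : ℝ) < n := by linarith
  have hL4 : 4 ≤ L := by
    rw [hL, Real.le_logb_iff_rpow_le one_lt_two hn0]
    norm_num
    exact hn
  have hlog : Real.log n = L * Real.log 2 := by
    rw [hL, Real.logb, div_mul_cancel₀ _ (Real.log_pos one_lt_two).ne']
  have hlog2 := Real.log_two_lt_d9
  have hlog2' := Real.log_two_gt_d9
  have hτ1 : α * L ≤ τ := Nat.le_ceil _
  have hτ2 : (τ : ℝ) < α * L + 1 := Nat.ceil_lt_add_one (by positivity)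
  have hτ'1 : 8 * d * τ * L ^ 2 ≤ τ' := Nat.le_ceil _
  have hτ'2 : (τ' : ℝ) < 8 * d * τ * L ^ 2 + 1 := Nat.ceil_lt_add_one (by positivity)
  have hτ4 : 2 ≤ (τ : ℝ) := by nlinarith
  have hLL : L ≤ L ^ 3 := le_self_pow₀ (by linarith) (by norm_num)
  have hkr : 9 * ((τ : ℝ) + 1) ≤ k n := by
    rw [Real.norm_of_nonneg (by positivity), Real.norm_of_nonneg (by positivity),
      one_div_mul_eq_div, le_div_iff₀ (by positivity)] at hkn
    refine le_trans ?_ hkn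
    nlinarith
  have hk9 : 9 * (τ + 1) ≤ k n := by exact_mod_cast hkr
  have hk0 : 0 < k n := by omega
  have hNk : n / k n * k n = n := Nat.div_mul_cancel hdvd
  set N := n / k n with hN
  intro tie
  have hNkr : (N : ℝ) * k n = n := by exact_mod_cast hNk
  have hN1 : 1 ≤ N := by
    rw [Nat.one_le_iff_ne_zero]
    rintro h0
    rw [h0] at hNk
    omega
  -- The rank bound is `6 * τ + 4 ≤ 8 * τ`, as `τ ≥ 2`; harmonic numbers are at most `1 + L * log 2
  -- ≤ L`, as `L ≥ 4`.
  have key := basicAlgorithm_le (N := N) (τ' := τ') hk9 (r := 8 * τ) (H := L)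
    (by push_cast; linarith) (by
      intro b hb
      rcases b.eq_zero_or_pos with rfl | hb0
      · simp; linarith
      refine (harmonic_le_one_add_log b).trans ?_
      have : Real.log b ≤ Real.log n :=
        Real.log_le_log (by exact_mod_cast hb0) (by rw [hNk] at hb; exact_mod_cast hb)
      nlinarith) (by linarith) tie N
  set good : Set (Config (Fin N × Fin (k n))) :=
    {c | Spread (1 + τ + 2 * τ) N c ∧ c.t = 1 + τ + N * τ'}
  have hexp : ∀ x : ℝ, (c + 4) * Real.log n ≤ x → Real.exp (-x) ≤ (n : ℝ) ^ (-(c + 4)) := by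
    intro x hx
    rw [Real.rpow_def_of_pos hn0]
    refine Real.exp_le_exp.2 ?_
    linarith
  -- The ranking exponent is at least `d * L` with `d > c + 3`. The factor `4/5` works because `(c +
  -- 4) * 4/5 ≤ c + 3` is equivalent to `c ≥ 1`.
  have hlogL : Real.log n ≤ 4 / 5 * L := by nlinarith
  have hlog0 : 0 ≤ Real.log n := Real.log_nonneg (by linarith)
  have he1 : Real.exp (-(τ / 4 : ℝ)) ≤ (n : ℝ) ^ (-(c + 4)) := by
    refine hexp _ ?_
    nlinarith
  have he2 : Real.exp (-(1 / (8 * (τ : ℝ) * L) * τ')) ≤ (n : ℝ) ^ (-(c + 4)) := by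
    refine hexp _ ?_
    have h1 : d * L ≤ 1 / (8 * (τ : ℝ) * L) * τ' := by
      rw [one_div_mul_eq_div, le_div_iff₀ (by positivity)]
      linarith
    nlinarith
  refine one_sub_le_toReal_toOuterMeasure (good := good) (by positivity) ?_ ?_
  · refine key.trans ?_
    rw [hNk]
    exact union_bound_le (by omega) (Nat.div_le_self n (k n)) he1 he2
  · rintro s ⟨hs, ht⟩
    refine ⟨fun u v => (hs.old u v ?_).1, ?_⟩
    -- All gaps are below `N`, so after `N` ranking phases every message is old.
    · unfold gap
      omega
    · have hnk : (n : ℝ) * L ^ 3 / (k n : ℝ) = N * L ^ 3 := by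
        have : (k n : ℝ) ≠ 0 := by exact_mod_cast hk0.ne'
        rw [← hNkr, mul_right_comm, mul_div_cancel_right₀ _ this]
      have hN1r : (1 : ℝ) ≤ N := by exact_mod_cast hN1
      rw [hnk, ht]
      push_cast
      exact rounds_le hα0.le hd0.le (by linarith) hN1r hτ2.le hτ'2.le
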